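/- Let $\mathbb{F}$ be a field and let $(C,d,\mathcal{F})$ be a filtered chain complex over $\mathbb{F}$: $C=\bigoplus_{n\in\mathbb{Z}}C_n$ is a $\mathbb{Z}$-graded $\mathbb{F}$-space, $d:C\to C$ satisfies $d^2=0$ and $d(C_n)\subset C_{n-1}$, and each $C_n$ carries an ascending $\mathbb{Z}$-filtration by subspaces $\mathcal{F}^pC_n$ with $d(\mathcal{F}^pC_n)\subset\mathcal{F}^pC_{n-1}$. Assume that for each $n$ there is a $p$ with $\mathcal{F}^pC_n=0$, and that $\dim_{\mathbb{F}}\mathcal{F}^pC_n<\infty$ for all $n,p$. Let $PH$ be the persistent homology, that is, the homology of $\bigoplus_{p}\mathcal{F}^pC$, with $x$ acting by the inclusions $\mathcal{F}^pC\subset\mathcal{F}^{p+1}C$; it is a bigraded $\mathbb{F}[x]$-module whose component of homological degree $n$ and module degree $p$ is $H_n(\mathcal{F}^pC)$. Let $\{E^{(r)}\}_{r\ge1}$ be the spectral sequence of $(C,d,\mathcal{F})$, where $E^{(r)}_{n,s}$ is the component of the $r$-th page with homological degree $n$ and filtration degree $s$. Thus $E^{(r)}_{n,s}=Z^r_{n,s}/B^r_{n,s}$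 and $E^{(\infty)}_{n,s}=\bigcap_rZ^r_{n,s}\big/\bigcup_rB^r_{n,s}$, where $$Z^r_{n,s}=\{c\in\mathcal{F}^sC_n: dc\in\mathcal{F}^{s-r}C_{n-1}\}+\mathcal{F}^{s-1}C_n,\qquad B^r_{n,s}=\bigl(\mathcal{F}^sC_n\cap d(\mathcal{F}^{s+r-1}C_{n+1})\bigr)+\mathcal{F}^{s-1}C_n .$$ For $n,s\in\mathbb{Z}$ and $m\in\mathbb{Z}_{>0}\cup\{\infty\}$ let $\mathbb{F}[x]/(x^m)\|n\|\{s\}$ (with $(x^\infty)=0$) be the cyclic module placed in homological degree $n$ with generator in module degree $s$. Then $PH$ is isomorphic, as a bigraded $\mathbb{F}[x]$-module, to a direct sum of such modules; in every such decomposition only finitely many summands have given $(n,s)$, and the number $\nu_{n,s,m}$ of summands of type $(n,s,m)$ does not depend on the decomposition. Moreover: 1. For all integers $r\ge1$ and $n,s$, the space $E^{(r)}_{n,s}$ is finite dimensional and $$\dim_{\mathbb{F}}E^{(r)}_{n,s}=\nu_{n,s,\infty}+\sum_{r\le m<\infty}(\nu_{n,s,m}+\nu_{n-1,s-m,m}),$$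 where the sum has only finitely many nonzero terms. Hence the persistent homology determines the spectral sequence: if $(C',d',\mathcal{F}')$ is a second filtered chain complex over $\mathbb{F}$ satisfying the same two assumptions and $PH\cong PH'$ as bigraded $\mathbb{F}[x]$-modules, then $E^{(r)}_{n,s}\cong E'^{(r)}_{n,s}$ for all $n,s$ and all $1\le r\le\infty$. 2. The spectral sequence collapses locally to $E^{(\infty)}$: for all $n,s$ there is an $r_{n,s}$ with $E^{(r)}_{n,s}\cong E^{(\infty)}_{n,s}$ for all $r>r_{n,s}$. The spaces $E^{(\infty)}_{n,s}$ are finite dimensional, and for all $n,s\in\mathbb{Z}$ and all integers $m\ge1$ - (a) $\nu_{n,s,\infty}=\dim_{\mathbb{F}}E^{(\infty)}_{n,s}$, - (b) $\nu_{n,s,m}=\dim_{\mathbb{F}}E^{(m)}_{n,s}-\dim_{\mathbb{F}}E^{(m+1)}_{n,s}-\nu_{n-1,s-m,m}$. If in addition the filtration is bounded below uniformly, that is, there is a $p$ with $\mathcal{F}^pC_n=0$ for all $n$, then there is an $S\in\mathbb{Z}$ with $\nu_{n,s,m}=0$ for all $s<S$ and all $n,m$, and the spectral sequence determines the persistent homology: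 if $(C',d',\mathcal{F}')$ satisfies the same two assumptions (boundedness below for each $n$, and local finite dimensionality) and $E^{(r)}_{n,s}\cong E'^{(r)}_{n,s}$ for all $n,s$ and all integers $r\ge1$, then $PH\cong PH'$ as bigraded $\mathbb{F}[x]$-modules. -/

import Mathlib

open Polynomial DirectSum

universe u v w

/-- A filtered chain complex `(C, d, 𝓕)` over a field `F`: the total space `C = ⨁ₙ Cₙ` with its
internal `ℤ`-grading `gr n = Cₙ`, a differential `d` of degree `-1`, and an ascending
`ℤ`-filtration of each `Cₙ` by subspaces `fil p n = 𝓕ᵖ Cₙ` which `d` respects. -/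
structure FilteredChainComplex (F : Type u) [Field F] (C : Type v) [AddCommGroup C]
    [Module F C] where
  /-- the component `Cₙ` -/
  gr : ℤ → Submodule F C
  isInternal : DirectSum.IsInternal gr
  /-- the differential -/
  d : C →ₗ[F] C
  d_comp_d : d ∘ₗ d = 0
  d_mem_gr : ∀ n, ∀ c ∈ gr n, d c ∈ gr (n - 1)
  /-- `fil p n` is `𝓕ᵖ Cₙ` -/
  fil : ℤ → ℤ → Submodule F C
  fil_le_gr : ∀ p n, fil p n ≤ gr n
  fil_mono : ∀ p q n, p ≤ q → fil p n ≤ fil q n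
  d_mem_fil : ∀ p n, ∀ c ∈ fil p n, d c ∈ fil p (n - 1)

/-- A bigraded `F[x]`-module, given by its homogeneous components: `comp n p` is the component of
homological degree `n` and `F[x]`-module degree `p`, and `x n p` is multiplication by the
indeterminate `x` on it (`x` has homological degree `0` and module degree `1`). -/
structure BigradedModule (F : Type u) [Field F] where
  comp : ℤ → ℤ → Type v
  [addCommGroup : ∀ n p, AddCommGroup (comp n p)]
  [module : ∀ n p, Module F (comp n p)]
  x : ∀ n p, comp n p →ₗ[F] comp n (p + 1)

namespace BigradedModule

attribute [instance] BigradedModule.addCommGroup BigradedModule.module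

variable {F : Type u} [Field F]

/-- Two bigraded `F[x]`-modules are isomorphic: there is a bijective `F[x]`-linear map preserving
both degrees. -/
def Iso (M : BigradedModule.{u, v} F) (N : BigradedModule.{u, w} F) : Prop :=
  ∃ e : ∀ n p, M.comp n p ≃ₗ[F] N.comp n p,
    ∀ n p a, e n (p + 1) (M.x n p a) = N.x n p (e n p a)

/-- The direct sum of a family of bigraded `F[x]`-modules. -/
def directSum {ι : Type w} (M : ι → BigradedModule.{u, v} F) :
    BigradedModule.{u, max v w} F where
  comp n p := ⨁ i, (M i).comp n p
  x n p := DirectSum.lmap fun i => (M i).x n p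

/-- The ideal `(x ^ m)` of `F[x]`, which is `0` for `m = ∞`. -/
noncomputable def powIdeal (F : Type u) [Field F] (m : ℕ∞) : Ideal F[X] :=
  Ideal.span {q | ∃ k : ℕ, (k : ℕ∞) = m ∧ q = X ^ k}

/-- The component of homological degree `n'` and module degree `p` of the bigraded module
`F[x] / (x ^ m)` placed in homological degree `n` and shifted by `s`: it is spanned by the class of
`x ^ k` with `p = s + k`, `k ≥ 0`, if `n' = n`, and is zero otherwise. -/
noncomputable def cyclicComp (F : Type u) [Field F] (n s : ℤ) (m : ℕ∞) (n' p : ℤ) :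
    Submodule F (F[X] ⧸ powIdeal F m) :=
  Submodule.span F
    {q | n' = n ∧ ∃ k : ℕ, p = s + k ∧ q = Ideal.Quotient.mk (powIdeal F m) (X ^ k)}

theorem mul_X_mem_cyclicComp (n s : ℤ) (m : ℕ∞) (n' p : ℤ) :
    ∀ q ∈ cyclicComp F n s m n' p,
      LinearMap.mulLeft F (Ideal.Quotient.mk (powIdeal F m) X) q ∈
        cyclicComp F n s m n' (p + 1) := by
  intro q hq
  refine Submodule.span_induction (p := fun q _ =>
    LinearMap.mulLeft F (Ideal.Quotient.mk (powIdeal F m) X) q ∈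
        cyclicComp F n s m n' (p + 1)) ?_ ?_ ?_ ?_ hq
  · rintro _ ⟨hn, k, rfl, rfl⟩
    refine Submodule.subset_span ⟨hn, k + 1, by push_cast; ring, ?_⟩
    rw [LinearMap.mulLeft_apply, ← map_mul, pow_succ']
  · rw [map_zero]; exact Submodule.zero_mem _
  · intro a b _ _ ha hb
    rw [map_add]; exact Submodule.add_mem _ ha hb
  · intro c a _ ha
    rw [map_smul]; exact Submodule.smul_mem _ c ha

/-- The bigraded `F[x]`-module `F[x] / (x ^ m) ‖n‖{s}`, with `F[x] ‖n‖{s}` for `m = ∞`. -/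
noncomputable def cyclic (F : Type u) [Field F] (n s : ℤ) (m : ℕ∞) : BigradedModule.{u, u} F where
  comp n' p := cyclicComp F n s m n' p
  x n' p := (LinearMap.mulLeft F (Ideal.Quotient.mk (powIdeal F m) X)).restrict
    (mul_X_mem_cyclicComp n s m n' p)

end BigradedModule

namespace FilteredChainComplex

variable {F : Type u} [Field F] {C : Type v} [AddCommGroup C] [Module F C]

/-- For each `n`, the filtration on `Cₙ` is bounded below. -/
def BoundedBelow (K : FilteredChainComplex F C) : Prop :=
  ∀ n, ∃ p, K.fil p n = ⊥

/-- The filtration is bounded below on the entire `C`, that is, uniformly in `n`. -/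
def UniformlyBoundedBelow (K : FilteredChainComplex F C) : Prop :=
  ∃ p, ∀ n, K.fil p n = ⊥

/-- All `𝓕ᵖ Cₙ` are finite dimensional. -/
def LocallyFiniteDimensional (K : FilteredChainComplex F C) : Prop :=
  ∀ p n, FiniteDimensional F (K.fil p n)

/-! ### Persistent homology -/

/-- The `n`-cycles of the subcomplex `𝓕ᵖ C`. -/
def cycles (K : FilteredChainComplex F C) (p n : ℤ) : Submodule F C :=
  K.fil p n ⊓ LinearMap.ker K.d

/-- The `n`-boundaries of the subcomplex `𝓕ᵖ C`. -/
def boundaries (K : FilteredChainComplex F C) (p n : ℤ) : Submodule F C :=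
  (K.fil p (n + 1)).map K.d

theorem cycles_mono (K : FilteredChainComplex F C) (p n : ℤ) :
    K.cycles p n ≤ K.cycles (p + 1) n :=
  inf_le_inf_right _ (K.fil_mono p (p + 1) n (by omega))

theorem boundaries_mono (K : FilteredChainComplex F C) (p n : ℤ) :
    K.boundaries p n ≤ K.boundaries (p + 1) n :=
  Submodule.map_mono (K.fil_mono p (p + 1) (n + 1) (by omega))

/-- The persistent homology `PH = H(PC, d_x)` of the persistent chain complex
`PC = ⨁ₚ 𝓕ᵖ C`, as a bigraded `F[x]`-module: its component in degrees `(n, p)` is `Hₙ(𝓕ᵖ C)`, and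
`x` acts by the maps induced by the inclusions `𝓕ᵖ C ⊆ 𝓕ᵖ⁺¹ C`. -/
def PH (K : FilteredChainComplex F C) : BigradedModule.{u, v} F where
  comp n p := K.cycles p n ⧸ (K.boundaries p n).submoduleOf (K.cycles p n)
  x n p := Submodule.mapQ _ _ (Submodule.inclusion (K.cycles_mono p n))
    fun _ hz => K.boundaries_mono p n hz

/-- `τ i = (n, s, m)` lists the types of the summands of a decomposition of `PH`: there is an
isomorphism of bigraded `F[x]`-modules `PH ≅ ⨁ᵢ F[x] / (x ^ m) ‖n‖{s}`, with `m` positive or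
infinite (a free summand). -/
def IsPHDecomposition (K : FilteredChainComplex F C) {ι : Type w} (τ : ι → ℤ × ℤ × ℕ∞) : Prop :=
  (∀ i, (τ i).2.2 ≠ 0) ∧
    K.PH.Iso (BigradedModule.directSum fun i =>
      BigradedModule.cyclic F (τ i).1 (τ i).2.1 (τ i).2.2)

/-- `ν n s m` is the multiplicity of the summand `F[x] / (x ^ m) ‖n‖{s}` in the decomposition of
`PH`: a decomposition exists, and in every decomposition there are only finitely many summands for
each pair `(n, s)`, exactly `ν n s m` of which have type `(n, s, m)`. -/
def IsMultiplicity (K : FilteredChainComplex F C) (ν : ℤ → ℤ → ℕ∞ → ℕ) : Prop :=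
  (∃ (ι : Type) (τ : ι → ℤ × ℤ × ℕ∞), K.IsPHDecomposition τ) ∧
    ∀ (ι : Type) (τ : ι → ℤ × ℤ × ℕ∞), K.IsPHDecomposition τ →
      (∀ n s, {i | (τ i).1 = n ∧ (τ i).2.1 = s}.Finite) ∧
      ∀ n s m, {i | τ i = (n, s, m)}.ncard = ν n s m

/-! ### The spectral sequence -/

/-- The preimage in `𝓕ˢ Cₙ` of the `r`-th approximate cycles in `𝓕ˢ Cₙ / 𝓕ˢ⁻¹ Cₙ`:
`{c ∈ 𝓕ˢ Cₙ | d c ∈ 𝓕ˢ⁻ʳ Cₙ₋₁} + 𝓕ˢ⁻¹ Cₙ`. -/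
def Z (K : FilteredChainComplex F C) (r : ℕ) (n s : ℤ) : Submodule F C :=
  (K.fil s n ⊓ (K.fil (s - r) (n - 1)).comap K.d) ⊔ K.fil (s - 1) n

/-- The preimage in `𝓕ˢ Cₙ` of the `r`-th approximate boundaries in `𝓕ˢ Cₙ / 𝓕ˢ⁻¹ Cₙ`:
`(𝓕ˢ Cₙ ∩ d(𝓕ˢ⁺ʳ⁻¹ Cₙ₊₁)) + 𝓕ˢ⁻¹ Cₙ`. -/
def B (K : FilteredChainComplex F C) (r : ℕ) (n s : ℤ) : Submodule F C :=
  (K.fil s n ⊓ (K.fil (s + r - 1) (n + 1)).map K.d) ⊔ K.fil (s - 1) n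

/-- The component `E⁽ʳ⁾_{n,s} = Zʳ / Bʳ` of the `r`-th page of the spectral sequence of
`(C, d, 𝓕)`, with homological degree `n` and filtration degree `s`. -/
abbrev page (K : FilteredChainComplex F C) (r : ℕ) (n s : ℤ) : Type v :=
  K.Z r n s ⧸ (K.B r n s).submoduleOf (K.Z r n s)

/-- The component `E⁽∞⁾_{n,s} = (⋂ᵣ Zʳ) / (⋃ᵣ Bʳ)` of the infinite page (`Zʳ` is decreasing and
`Bʳ` is increasing in `r`). -/
abbrev pageInfty (K : FilteredChainComplex F C) (n s : ℤ) : Type v :=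
  ↥(⨅ r, K.Z r n s) ⧸ (⨆ r, K.B r n s).submoduleOf (⨅ r, K.Z r n s)

/-- The spectral sequence collapses locally to `E⁽∞⁾`. -/
def CollapsesLocally (K : FilteredChainComplex F C) : Prop :=
  ∀ n s, ∃ r₀ : ℕ, ∀ r > r₀, Nonempty (K.page r n s ≃ₗ[F] K.pageInfty n s)

end FilteredChainComplex

/-!
Write a summand `F[x] / (x ^ m) ‖n‖{s}` as a bar, alive in homological degree `n` and module
degrees `s ≤ p < s + m`. By `BigradedModule.iso_directSum_cyclic_iff`, a decomposition of a
bigraded module is the same as an adapted basis (`BarBasis`): each homogeneous component has a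
basis indexed by the bars alive there, and `x` moves along the bars.

Existence. The generators of type `(n, s, m)` are cycles of `𝓕ˢ Cₙ` whose class is killed by `x ^
m`; they form a basis of a complement (`genSpace`) of those cycles which are, up to a boundary,
sums of cycles of `𝓕ˢ⁻¹ Cₙ` and cycles killed by a smaller power of `x`. They span by induction on
the module degree, which starts because the filtration is bounded below
(`cycles_le_aliveSpan_sup`). They are independent because in a relation the type with the
lexicographically largest `(s, m)` is isolated (`eq_zero_of_linearCombination_mem_boundaries`).
The index type of this decomposition depends only on the multiplicities, so equal multiplicities
give isomorphic persistent homology at once.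

Counting. The number of bars alive at both `p` and `q` is the rank of `Hₙ(𝓕ᵖ C) → Hₙ(𝓕^q C)`,
hence equal to `dim (cycles of 𝓕ᵖ Cₙ) - dim (𝓕ᵖ Cₙ ∩ d(𝓕^q Cₙ₊₁))` (`ncard_aliveSet_add`). This
makes the multiplicities independent of the decomposition. Rank–nullity expresses `dim Zʳ` and
`dim Bʳ` through the same numbers, and comparing gives `finrank_page`: `dim E⁽ʳ⁾_{n,s}` is the
number of bars of length at least `r` which are born at `s` in degree `n` or die at `s` in degree
`n - 1`. As only finitely many bars have an end at `s`, the finite bars drop out for large `r`;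
there `Zʳ` and `Bʳ` are stationary, and the count is `dim E⁽∞⁾`. Conversely, the differences of
consecutive pages give the multiplicities by induction on `s`, once a uniform lower bound provides
a start (`mult_eq_of_finrank_page_eq`).
-/

/-! ### Adapted bases of bigraded modules -/

namespace BigradedModule

variable {F : Type u} [Field F]

theorem Iso.symm {M : BigradedModule.{u, v} F} {N : BigradedModule.{u, w} F} (h : M.Iso N) :
    N.Iso M := by
  obtain ⟨e, he⟩ := h
  refine ⟨fun n p => (e n p).symm, fun n p a => ?_⟩
  rw [LinearEquiv.symm_apply_eq, he, LinearEquiv.apply_symm_apply]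

/-- The bar `t = (n, s, m)`, which stands for the module `F[x] / (x ^ m) ‖n‖{s}`, is alive in
homological degree `n'` and module degree `p` if `n' = n` and `s ≤ p < s + m`. -/
def IsAlive (t : ℤ × ℤ × ℕ∞) (n p : ℤ) : Prop :=
  t.1 = n ∧ ∃ k : ℕ, p = t.2.1 + k ∧ (k : ℕ∞) < t.2.2

theorem IsAlive.of_le {t : ℤ × ℤ × ℕ∞} {n p q : ℤ} (h : IsAlive t n q) (hs : t.2.1 ≤ p)
    (hpq : p ≤ q) : IsAlive t n p := by
  obtain ⟨h1, k, hk, hkm⟩ := h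
  refine ⟨h1, (p - t.2.1).toNat, by omega, lt_of_le_of_lt ?_ hkm⟩
  exact_mod_cast (by omega : (p - t.2.1).toNat ≤ k)

theorem IsAlive.le {t : ℤ × ℤ × ℕ∞} {n p : ℤ} (h : IsAlive t n p) : t.2.1 ≤ p := by
  obtain ⟨_, k, hk, _⟩ := h
  omega

/-- A basis of the bigraded `F[x]`-module `M` adapted to a family of bars `τ`: each homogeneous
component has a basis indexed by the bars alive in its degrees, and `x` maps a basis vector to the
basis vector of the same bar if that bar is still alive, and to zero otherwise. -/
structure BarBasis (M : BigradedModule.{u, v} F) {ι : Type w} (τ : ι → ℤ × ℤ × ℕ∞) where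
  /-- the basis of the component `M.comp n p` -/
  basis : ∀ n p, Module.Basis {i // IsAlive (τ i) n p} F (M.comp n p)
  x_basis : ∀ n p i (h : IsAlive (τ i) n p) (h' : IsAlive (τ i) n (p + 1)),
    M.x n p (basis n p ⟨i, h⟩) = basis n (p + 1) ⟨i, h'⟩
  x_basis_eq_zero : ∀ n p i (h : IsAlive (τ i) n p), ¬ IsAlive (τ i) n (p + 1) →
    M.x n p (basis n p ⟨i, h⟩) = 0

theorem BarBasis.iso {M : BigradedModule.{u, v} F} {ι : Type*} {τ : ι → ℤ × ℤ × ℕ∞}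
    {N : BigradedModule.{u, w} F} (b : BarBasis M τ) (c : BarBasis N τ) : M.Iso N := by
  refine ⟨fun n p => (b.basis n p).equiv (c.basis n p) (Equiv.refl _), fun n p a => ?_⟩
  have : ((b.basis n (p + 1)).equiv (c.basis n (p + 1)) (Equiv.refl _)).toLinearMap ∘ₗ M.x n p
      = N.x n p ∘ₗ ((b.basis n p).equiv (c.basis n p) (Equiv.refl _)).toLinearMap := by
    refine (b.basis n p).ext fun ⟨i, h⟩ => ?_
    by_cases h' : IsAlive (τ i) n (p + 1)
    · simp [b.x_basis n p i h h', c.x_basis n p i h h']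
    · simp [b.x_basis_eq_zero n p i h h', c.x_basis_eq_zero n p i h h']
  exact LinearMap.congr_fun this a

/-- Transport of an adapted basis along an isomorphism. -/
noncomputable def BarBasis.ofIso {M : BigradedModule.{u, v} F} {ι : Type*} {τ : ι → ℤ × ℤ × ℕ∞}
    {N : BigradedModule.{u, w} F} (b : BarBasis M τ) (e : ∀ n p, M.comp n p ≃ₗ[F] N.comp n p)
    (he : ∀ n p a, e n (p + 1) (M.x n p a) = N.x n p (e n p a)) : BarBasis N τ where
  basis n p := (b.basis n p).map (e n p)
  x_basis n p i h h' := by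
    simp only [Module.Basis.map_apply]
    rw [← he, b.x_basis n p i h h']
  x_basis_eq_zero n p i h h' := by
    simp only [Module.Basis.map_apply]
    rw [← he, b.x_basis_eq_zero n p i h h', map_zero]

/-! ### Direct sums of cyclic modules -/

theorem X_pow_mem_powIdeal_iff (m : ℕ∞) (k : ℕ) :
    (X ^ k : F[X]) ∈ powIdeal F m ↔ m ≤ k := by
  induction m using ENat.recTopCoe with
  | top =>
    have : powIdeal F ⊤ = ⊥ := by
      rw [powIdeal, Ideal.span_eq_bot]
      rintro q ⟨j, hj, _⟩
      exact absurd hj (ENat.natCast_ne_top j)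
    simp [this]
  | coe j =>
    have : powIdeal F (j : ℕ∞) = Ideal.span {X ^ j} := by
      rw [powIdeal]
      congr 1
      ext q
      simp
    rw [this, Ideal.mem_span_singleton, Nat.cast_le]
    exact pow_dvd_pow_iff X_ne_zero not_isUnit_X

/-- The component of the cyclic module of the bar `t` has a basis with one element, the class of the
appropriate power of `x`, if the bar is alive, and the empty basis otherwise. -/
noncomputable def cyclicBasis (F : Type u) [Field F] (t : ℤ × ℤ × ℕ∞) (n p : ℤ) :
    Module.Basis (PLift (IsAlive t n p)) F (cyclicComp F t.1 t.2.1 t.2.2 n p) :=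
  Module.Basis.mk (v := fun h => ⟨Ideal.Quotient.mk (powIdeal F t.2.2) (X ^ (p - t.2.1).toNat),
      Submodule.subset_span ⟨h.down.1.symm, (p - t.2.1).toNat, by
        obtain ⟨_, k, hk, _⟩ := h.down
        omega, rfl⟩⟩)
    (by
      rw [linearIndependent_subsingleton_index_iff]
      rintro ⟨h1, k, rfl, hk⟩ h0
      rw [Subtype.ext_iff] at h0
      simp only [add_sub_cancel_left, Int.toNat_natCast, ZeroMemClass.coe_zero,
        Ideal.Quotient.eq_zero_iff_mem, X_pow_mem_powIdeal_iff] at h0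
      exact absurd h0 (not_le.2 hk))
    (by
      rintro ⟨q, hq⟩ -
      refine Submodule.span_induction (p := fun q hq =>
        (⟨q, hq⟩ : cyclicComp F t.1 t.2.1 t.2.2 n p) ∈ Submodule.span F (Set.range _))
        ?_ ?_ ?_ ?_ hq
      · rintro _ ⟨hn, k, rfl, rfl⟩
        by_cases hk : (k : ℕ∞) < t.2.2
        · refine Submodule.subset_span ⟨⟨hn.symm, k, rfl, hk⟩, ?_⟩
          simp
        · convert Submodule.zero_mem _
          rw [Subtype.ext_iff]
          exact Ideal.Quotient.eq_zero_iff_mem.2 ((X_pow_mem_powIdeal_iff _ _).2 (not_lt.1 hk))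
      · exact Submodule.zero_mem _
      · intro a b _ _ ha hb
        exact Submodule.add_mem _ ha hb
      · intro c a _ ha
        exact Submodule.smul_mem _ c ha)

theorem coe_cyclicBasis (t : ℤ × ℤ × ℕ∞) (n p : ℤ) (h : PLift (IsAlive t n p)) :
    ((cyclicBasis F t n p h : cyclicComp F t.1 t.2.1 t.2.2 n p) : F[X] ⧸ powIdeal F t.2.2) =
      Ideal.Quotient.mk (powIdeal F t.2.2) (X ^ (p - t.2.1).toNat) := by
  rw [cyclicBasis, Module.Basis.mk_apply]

theorem coe_mulX_cyclicBasis (t : ℤ × ℤ × ℕ∞) (n p : ℤ) (h : PLift (IsAlive t n p)) :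
    ((LinearMap.mulLeft F (Ideal.Quotient.mk (powIdeal F t.2.2) X)).restrict
      (mul_X_mem_cyclicComp t.1 t.2.1 t.2.2 n p) (cyclicBasis F t n p h)).1 =
      Ideal.Quotient.mk (powIdeal F t.2.2) (X ^ (p + 1 - t.2.1).toNat) := by
  have hle := h.down.le
  have : (p + 1 - t.2.1).toNat = (p - t.2.1).toNat + 1 := by omega
  rw [this, pow_succ', map_mul, ← coe_cyclicBasis t n p h]
  rfl

theorem mulX_cyclicBasis (t : ℤ × ℤ × ℕ∞) (n p : ℤ) (h : PLift (IsAlive t n p))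
    (h' : PLift (IsAlive t n (p + 1))) :
    (LinearMap.mulLeft F (Ideal.Quotient.mk (powIdeal F t.2.2) X)).restrict
      (mul_X_mem_cyclicComp t.1 t.2.1 t.2.2 n p) (cyclicBasis F t n p h) =
      cyclicBasis F t n (p + 1) h' := by
  apply Subtype.ext
  rw [coe_cyclicBasis, coe_mulX_cyclicBasis]

theorem mulX_cyclicBasis_eq_zero (t : ℤ × ℤ × ℕ∞) (n p : ℤ) (h : PLift (IsAlive t n p))
    (h' : ¬ IsAlive t n (p + 1)) :
    (LinearMap.mulLeft F (Ideal.Quotient.mk (powIdeal F t.2.2) X)).restrict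
      (mul_X_mem_cyclicComp t.1 t.2.1 t.2.2 n p) (cyclicBasis F t n p h) = 0 := by
  apply Subtype.ext
  refine (coe_mulX_cyclicBasis t n p h).trans (Ideal.Quotient.eq_zero_iff_mem.2 ?_)
  rw [X_pow_mem_powIdeal_iff]
  by_contra hlt
  have hle := h.down.le
  exact h' ⟨h.down.1, (p + 1 - t.2.1).toNat, by omega, not_le.1 hlt⟩

open Classical in
/-- The union of the bases of the components of a family of cyclic modules. -/
noncomputable def directSumBasis (F : Type u) [Field F] {ι : Type w} (τ : ι → ℤ × ℤ × ℕ∞)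
    (n p : ℤ) : Module.Basis {i // IsAlive (τ i) n p} F
      (⨁ i, cyclicComp F (τ i).1 (τ i).2.1 (τ i).2.2 n p) :=
  (DFinsupp.basis fun i => cyclicBasis F (τ i) n p).reindex (Equiv.sigmaPLiftEquivSubtype _)

open Classical in
theorem directSumBasis_apply {ι : Type w} (τ : ι → ℤ × ℤ × ℕ∞) (n p : ℤ) (i : ι)
    (h : IsAlive (τ i) n p) :
    directSumBasis F τ n p ⟨i, h⟩ = DirectSum.lof F ι
      (fun i => cyclicComp F (τ i).1 (τ i).2.1 (τ i).2.2 n p) i (cyclicBasis F (τ i) n p ⟨h⟩) := by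
  rw [directSumBasis, Module.Basis.reindex_apply]
  change DFinsupp.basis (fun i => cyclicBasis F (τ i) n p) ⟨i, ⟨h⟩⟩ = _
  apply (DFinsupp.basis (fun i => cyclicBasis F (τ i) n p)).repr.injective
  rw [Module.Basis.repr_self]
  ext ⟨j, hj⟩
  change _ = (cyclicBasis F (τ j) n p).repr (DFinsupp.single
    (β := fun i => cyclicComp F (τ i).1 (τ i).2.1 (τ i).2.2 n p) i
    (cyclicBasis F (τ i) n p ⟨h⟩) j) hj
  by_cases hij : i = j
  · subst hij
    simp
  · rw [DFinsupp.single_eq_of_ne (Ne.symm hij), map_zero, Finsupp.single_eq_of_ne (by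
      simp [Ne.symm hij])]
    rfl

open Classical in
/-- The adapted basis of a direct sum of cyclic modules. -/
noncomputable def directSumBarBasis (F : Type u) [Field F] {ι : Type w} (τ : ι → ℤ × ℤ × ℕ∞) :
    BarBasis (directSum fun i => cyclic F (τ i).1 (τ i).2.1 (τ i).2.2) τ where
  basis n p := directSumBasis F τ n p
  x_basis n p i h h' := by
    change DirectSum.lmap (fun i =>
      (LinearMap.mulLeft F (Ideal.Quotient.mk (powIdeal F (τ i).2.2) X)).restrict
        (mul_X_mem_cyclicComp (τ i).1 (τ i).2.1 (τ i).2.2 n p))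
      (directSumBasis F τ n p ⟨i, h⟩) = directSumBasis F τ n (p + 1) ⟨i, h'⟩
    rw [directSumBasis_apply, directSumBasis_apply, DirectSum.lmap_lof, mulX_cyclicBasis]
  x_basis_eq_zero n p i h h' := by
    change DirectSum.lmap (fun i =>
      (LinearMap.mulLeft F (Ideal.Quotient.mk (powIdeal F (τ i).2.2) X)).restrict
        (mul_X_mem_cyclicComp (τ i).1 (τ i).2.1 (τ i).2.2 n p))
      (directSumBasis F τ n p ⟨i, h⟩) = 0
    rw [directSumBasis_apply, DirectSum.lmap_lof, mulX_cyclicBasis_eq_zero _ _ _ _ h', map_zero]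

theorem iso_directSum_cyclic_iff (M : BigradedModule.{u, v} F) {ι : Type w}
    (τ : ι → ℤ × ℤ × ℕ∞) :
    M.Iso (directSum fun i => cyclic F (τ i).1 (τ i).2.1 (τ i).2.2) ↔
      Nonempty (BarBasis M τ) := by
  constructor
  · intro h
    obtain ⟨e, he⟩ := h.symm
    exact ⟨(directSumBarBasis F τ).ofIso e he⟩
  · rintro ⟨b⟩
    exact b.iso (directSumBarBasis F τ)

end BigradedModule

/-! ### Generators of the persistent homology -/

theorem Submodule.exists_le_disjoint_sup {F : Type*} [Field F] {C : Type*} [AddCommGroup C]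
    [Module F C] (A B : Submodule F C) : ∃ W ≤ B, Disjoint W A ∧ B ≤ W ⊔ A := by
  obtain ⟨D, hD⟩ := Submodule.exists_isCompl (A ⊓ B)
  refine ⟨B ⊓ D, inf_le_left, ?_, ?_⟩
  · rw [disjoint_iff, eq_bot_iff, ← hD.inf_eq_bot]
    exact le_inf (le_inf inf_le_right (inf_le_left.trans inf_le_left))
      (inf_le_left.trans inf_le_right)
  · intro c hc
    have hct : c ∈ (A ⊓ B) ⊔ D := by rw [hD.sup_eq_top]; trivial
    obtain ⟨a, ha, e, he, rfl⟩ := Submodule.mem_sup.1 hct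
    rw [add_comm]
    refine Submodule.add_mem_sup ⟨?_, he⟩ ha.1
    simpa using B.sub_mem hc ha.2

namespace FilteredChainComplex

variable {F : Type u} [Field F] {C : Type v} [AddCommGroup C] [Module F C]
  (K : FilteredChainComplex F C)

theorem cycles_le_cycles {p q : ℤ} (n : ℤ) (h : p ≤ q) : K.cycles p n ≤ K.cycles q n :=
  inf_le_inf_right _ (K.fil_mono p q n h)

theorem boundaries_le_boundaries {p q : ℤ} (n : ℤ) (h : p ≤ q) :
    K.boundaries p n ≤ K.boundaries q n :=
  Submodule.map_mono (K.fil_mono p q (n + 1) h)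

theorem boundaries_le_ker (p n : ℤ) : K.boundaries p n ≤ LinearMap.ker K.d := by
  rintro _ ⟨c, -, rfl⟩
  exact LinearMap.congr_fun K.d_comp_d c

theorem boundaries_le_cycles (p n : ℤ) : K.boundaries p n ≤ K.cycles p n := by
  refine le_inf ?_ (K.boundaries_le_ker p n)
  rintro _ ⟨c, hc, rfl⟩
  simpa using K.d_mem_fil p (n + 1) c hc

/-- The cycles of `𝓕ˢ Cₙ` whose homology class is annihilated by `x ^ m`, that is, which bound in
`𝓕ˢ⁺ᵐ C`; all cycles of `𝓕ˢ Cₙ` if `m = ∞`. Here `t = (n, s, m)`. -/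
def dyingCycles (t : ℤ × ℤ × ℕ∞) : Submodule F C :=
  K.cycles t.2.1 t.1 ⊓ ⨅ (k : ℕ) (_ : t.2.2 = k), K.boundaries (t.2.1 + k) t.1

/-- The cycles of `𝓕ˢ Cₙ` whose homology class is a sum of a class coming from `𝓕ˢ⁻¹ C` and
classes annihilated by `x ^ k` with `k < m`. Here `t = (n, s, m)`. -/
def oldCycles (t : ℤ × ℤ × ℕ∞) : Submodule F C :=
  K.cycles (t.2.1 - 1) t.1 ⊔ K.boundaries t.2.1 t.1 ⊔
    ⨆ (k : ℕ) (_ : (k : ℕ∞) < t.2.2), K.dyingCycles (t.1, t.2.1, k)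

theorem dyingCycles_le_cycles (t : ℤ × ℤ × ℕ∞) : K.dyingCycles t ≤ K.cycles t.2.1 t.1 :=
  inf_le_left

theorem dyingCycles_top (n s : ℤ) : K.dyingCycles (n, s, ⊤) = K.cycles s n := by
  refine le_antisymm inf_le_left (le_inf le_rfl (le_iInf₂ fun k hk => ?_))
  exact absurd hk.symm (ENat.natCast_ne_top k)

theorem dyingCycles_coe (n s : ℤ) (k : ℕ) :
    K.dyingCycles (n, s, k) = K.cycles s n ⊓ K.boundaries (s + k) n := by
  simp [dyingCycles]

theorem dyingCycles_le_boundaries (t : ℤ × ℤ × ℕ∞) {p : ℤ} {k : ℕ} (hk : t.2.2 ≤ k)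
    (hp : t.2.1 + k ≤ p) : K.dyingCycles t ≤ K.boundaries p t.1 := by
  obtain ⟨n, s, m⟩ := t
  obtain ⟨j, rfl⟩ := ENat.ne_top_iff_exists.1 (ne_top_of_le_ne_top (ENat.natCast_ne_top k) hk)
  rw [dyingCycles_coe]
  have : j ≤ k := Nat.cast_le.1 hk
  exact inf_le_right.trans (K.boundaries_le_boundaries n (by simp only at hp; omega))

theorem dyingCycles_le_oldCycles {n s : ℤ} {m m' : ℕ∞} (h : m' < m) :
    K.dyingCycles (n, s, m') ≤ K.oldCycles (n, s, m) := by
  obtain ⟨j, rfl⟩ := ENat.ne_top_iff_exists.1 (ne_top_of_lt h)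
  exact le_sup_of_le_right (le_iSup₂_of_le j h le_rfl)

/-- A complement of `K.oldCycles t` in `K.dyingCycles t`: the space spanned by the generators of the
summands of type `t` in a decomposition of `PH`. -/
noncomputable def genSpace (t : ℤ × ℤ × ℕ∞) : Submodule F C :=
  (Submodule.exists_le_disjoint_sup (K.oldCycles t) (K.dyingCycles t)).choose

theorem genSpace_le (t : ℤ × ℤ × ℕ∞) : K.genSpace t ≤ K.dyingCycles t :=
  (Submodule.exists_le_disjoint_sup (K.oldCycles t) (K.dyingCycles t)).choose_spec.1

theorem disjoint_genSpace (t : ℤ × ℤ × ℕ∞) : Disjoint (K.genSpace t) (K.oldCycles t) :=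
  (Submodule.exists_le_disjoint_sup (K.oldCycles t) (K.dyingCycles t)).choose_spec.2.1

theorem dyingCycles_le (t : ℤ × ℤ × ℕ∞) : K.dyingCycles t ≤ K.genSpace t ⊔ K.oldCycles t :=
  (Submodule.exists_le_disjoint_sup (K.oldCycles t) (K.dyingCycles t)).choose_spec.2.2

/-- The multiplicity of the summand of type `t` in the decomposition of `PH`. -/
noncomputable def mult (t : ℤ × ℤ × ℕ∞) : ℕ := Module.finrank F (K.genSpace t)

theorem genSpace_eq_bot (n s : ℤ) : K.genSpace (n, s, 0) = ⊥ := by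
  refine disjoint_self.1 ((K.disjoint_genSpace _).mono_right ?_)
  refine ((K.genSpace_le _).trans ?_).trans (le_sup_of_le_left le_sup_right)
  exact K.dyingCycles_le_boundaries _ (k := 0) le_rfl (by simp)

theorem mult_zero (n s : ℤ) : K.mult (n, s, 0) = 0 := by
  rw [mult, genSpace_eq_bot, finrank_bot]

variable {K}


theorem LocallyFiniteDimensional.of_le_fil (hfin : K.LocallyFiniteDimensional) {p n : ℤ}
    {A : Submodule F C} (h : A ≤ K.fil p n) :
    FiniteDimensional F A :=
  have := hfin p n
  Submodule.finiteDimensional_of_le h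

theorem finiteDimensional_genSpace (hfin : K.LocallyFiniteDimensional)
    (t : ℤ × ℤ × ℕ∞) : FiniteDimensional F (K.genSpace t) :=
  hfin.of_le_fil ((K.genSpace_le t).trans (inf_le_left.trans inf_le_left))

/-- The generators of the summands of `PH`, as cycles in `C`: for each type `t`, a basis of
`K.genSpace t`. -/
noncomputable def gen (hfin : K.LocallyFiniteDimensional) (i : Σ t, Fin (K.mult t)) : C :=
  have := finiteDimensional_genSpace hfin i.1
  (Module.finBasis F (K.genSpace i.1) i.2 : C)

variable (hfin : K.LocallyFiniteDimensional)

theorem gen_mem (i : Σ t, Fin (K.mult t)) : gen hfin i ∈ K.genSpace i.1 := by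
  rw [gen]
  exact Subtype.property _

theorem linearIndependent_gen (t : ℤ × ℤ × ℕ∞) :
    LinearIndependent F fun a : Fin (K.mult t) => gen hfin ⟨t, a⟩ := by
  have := finiteDimensional_genSpace hfin t
  exact (Module.finBasis F (K.genSpace t)).linearIndependent.map' (K.genSpace t).subtype
    (Submodule.ker_subtype _)

theorem genSpace_le_span (t : ℤ × ℤ × ℕ∞) :
    K.genSpace t ≤ Submodule.span F (Set.range fun a : Fin (K.mult t) => gen hfin ⟨t, a⟩) := by
  have := finiteDimensional_genSpace hfin t
  have h : Submodule.span F (Set.range (Module.finBasis F (K.genSpace t))) = ⊤ :=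
    (Module.finBasis F (K.genSpace t)).span_eq
  have h' := congrArg (Submodule.map (K.genSpace t).subtype) h
  rw [Submodule.map_span, Submodule.map_top, Submodule.range_subtype, ← Set.range_comp] at h'
  exact h'.ge

theorem genSpace_le_cycles {t : ℤ × ℤ × ℕ∞} {p n : ℤ} (ht : t.1 = n) (hp : t.2.1 ≤ p) :
    K.genSpace t ≤ K.cycles p n := by
  subst ht
  exact (K.genSpace_le t).trans ((K.dyingCycles_le_cycles t).trans (K.cycles_le_cycles _ hp))

theorem genSpace_le_boundaries {t : ℤ × ℤ × ℕ∞} {p n : ℤ} (ht : t.1 = n) (hp : t.2.1 ≤ p)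
    (h : ¬ BigradedModule.IsAlive t n p) : K.genSpace t ≤ K.boundaries p n := by
  subst ht
  refine (K.genSpace_le t).trans
    (K.dyingCycles_le_boundaries t (k := (p - t.2.1).toNat) ?_ (by omega))
  by_contra hlt
  exact h ⟨rfl, (p - t.2.1).toNat, by omega, not_le.1 hlt⟩

/-! ### The generators form an adapted basis -/

/-- The span of the generators alive in homological degree `n` and module degree `p`. -/
def aliveSpan (n p : ℤ) : Submodule F C :=
  Submodule.span F
    (Set.range fun i : {i : Σ t, Fin (K.mult t) // BigradedModule.IsAlive i.1 n p} =>
      gen hfin i.1)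

theorem genSpace_le_aliveSpan_sup {t : ℤ × ℤ × ℕ∞} {p n : ℤ} (ht : t.1 = n) (hp : t.2.1 ≤ p) :
    K.genSpace t ≤ aliveSpan hfin n p ⊔ K.boundaries p n := by
  by_cases h : BigradedModule.IsAlive t n p
  · refine ((genSpace_le_span hfin t).trans (Submodule.span_mono ?_)).trans le_sup_left
    rintro _ ⟨a, rfl⟩
    exact ⟨⟨⟨t, a⟩, h⟩, rfl⟩
  · exact (genSpace_le_boundaries ht hp h).trans le_sup_right

theorem aliveSpan_le (n p : ℤ) :
    aliveSpan hfin n p ≤ aliveSpan hfin n (p + 1) ⊔ K.boundaries (p + 1) n := by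
  refine Submodule.span_le.2 ?_
  rintro _ ⟨⟨i, hi⟩, rfl⟩
  exact genSpace_le_aliveSpan_sup hfin hi.1 (by have := hi.le; omega) (gen_mem hfin i)

/-- Each class killed by `x ^ m` is the sum of a combination of generators of type `(n, p, m)`, a
class from the previous module degree and classes killed by smaller powers of `x`. -/
theorem dyingCycles_le_aliveSpan_sup {n p : ℤ}
    (h : K.cycles (p - 1) n ≤ aliveSpan hfin n p ⊔ K.boundaries p n) (m : ℕ∞) :
    K.dyingCycles (n, p, m) ≤ aliveSpan hfin n p ⊔ K.boundaries p n := by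
  induction m using WellFoundedLT.induction with
  | ind m ih =>
    refine (K.dyingCycles_le _).trans (sup_le (genSpace_le_aliveSpan_sup hfin rfl le_rfl) ?_)
    exact sup_le (sup_le h le_sup_right) (iSup₂_le fun k hk => ih k hk)

theorem cycles_le_aliveSpan_sup (hK : K.BoundedBelow) (n p : ℤ) :
    K.cycles p n ≤ aliveSpan hfin n p ⊔ K.boundaries p n := by
  obtain ⟨p₀, hp₀⟩ := hK n
  have hbot : ∀ p ≤ p₀, K.cycles p n ≤ aliveSpan hfin n p ⊔ K.boundaries p n := fun p hp =>
    (inf_le_left.trans ((K.fil_mono p p₀ n hp).trans hp₀.le)).trans bot_le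
  rcases le_total p p₀ with hp | hp
  · exact hbot p hp
  induction p, hp using Int.leInduction with
  | base => exact hbot p₀ le_rfl
  | succ p hp ih =>
    rw [← K.dyingCycles_top]
    refine dyingCycles_le_aliveSpan_sup hfin ?_ ⊤
    rw [add_sub_cancel_right]
    exact ih.trans (sup_le (aliveSpan_le hfin n p)
      ((K.boundaries_mono p n).trans le_sup_right))

/-- A linear combination of generators alive in the same degrees which is a boundary is trivial.
Among the types of the generators involved, the one with the latest birth, and the longest life
among these, is isolated: all other terms lie in its space of old cycles. -/
theorem eq_zero_of_linearCombination_mem_boundaries (n p : ℤ)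
    (l : {i : Σ t, Fin (K.mult t) // BigradedModule.IsAlive i.1 n p} →₀ F)
    (hl : Finsupp.linearCombination F (fun i => gen hfin i.1) l ∈ K.boundaries p n) : l = 0 := by
  classical
  by_contra h0
  obtain ⟨i₀, hi₀, hmax⟩ := l.support.exists_max_image
    (fun i => toLex (i.1.1.2.1, i.1.1.2.2)) (Finsupp.support_nonempty_iff.2 h0)
  obtain ⟨⟨⟨n', s, m⟩, a₀⟩, halive⟩ := i₀
  obtain rfl : n' = n := halive.1
  have hb : K.boundaries p n' ⊓ K.cycles s n' ≤ K.oldCycles (n', s, m) := by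
    obtain ⟨-, k, rfl, hk⟩ := halive
    rw [inf_comm, ← K.dyingCycles_coe]
    exact K.dyingCycles_le_oldCycles hk
  have hcyc : ∀ i ∈ l.support, gen hfin i.1 ∈ K.cycles s n' := fun i hi => by
    refine genSpace_le_cycles i.2.1 ?_ (gen_mem hfin i.1)
    exact (Prod.Lex.le_iff.1 (hmax i hi)).elim le_of_lt fun h => h.1.le
  have hold : ∀ i ∈ l.support, ¬ i.1.1 = (n', s, m) →
      gen hfin i.1 ∈ K.oldCycles (n', s, m) := by
    rintro ⟨⟨⟨n₁, s₁, m₁⟩, a₁⟩, h₁⟩ hi hne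
    obtain rfl : n₁ = n' := h₁.1
    have hgen := K.genSpace_le _ (gen_mem hfin ⟨(n₁, s₁, m₁), a₁⟩)
    rcases Prod.Lex.lt_iff.1 (lt_of_le_of_ne (hmax _ hi) (by
      intro h
      simp only [EmbeddingLike.apply_eq_iff_eq, Prod.mk.injEq] at h
      exact hne (Prod.ext rfl (Prod.ext h.1 h.2)))) with h | h
    · have h : s₁ < s := h
      exact (le_sup_of_le_left le_sup_left : _ ≤ K.oldCycles _)
        (K.cycles_le_cycles n₁ (by omega : s₁ ≤ s - 1)
        (K.dyingCycles_le_cycles _ hgen))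
    · obtain ⟨h1, h2⟩ := h
      obtain rfl : s₁ = s := h1
      exact K.dyingCycles_le_oldCycles h2 hgen
  rw [Finsupp.linearCombination_apply, Finsupp.sum] at hl
  have htot : ∑ i ∈ l.support, l i • gen hfin i.1 ∈ K.oldCycles (n', s, m) :=
    hb ⟨hl, Submodule.sum_mem _ fun i hi => Submodule.smul_mem _ _ (hcyc i hi)⟩
  rw [← Finset.sum_filter_add_sum_filter_not _ fun i => i.1.1 = (n', s, m)] at htot
  have hnew : ∑ i ∈ l.support with i.1.1 = (n', s, m), l i • gen hfin i.1 = 0 := by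
    refine Submodule.disjoint_def.1 (K.disjoint_genSpace (n', s, m)) _ ?_ ?_
    · refine Submodule.sum_mem _ fun i hi => Submodule.smul_mem _ _ ?_
      rw [← (Finset.mem_filter.1 hi).2]
      exact gen_mem hfin i.1
    · refine (Submodule.add_mem_iff_left _ ?_).1 htot
      refine Submodule.sum_mem _ fun i hi => Submodule.smul_mem _ _ ?_
      exact hold i (Finset.mem_filter.1 hi).1 (Finset.mem_filter.1 hi).2
  let e : Fin (K.mult (n', s, m)) → {i : Σ t, Fin (K.mult t) // BigradedModule.IsAlive i.1 n' p} :=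
    fun a => ⟨⟨(n', s, m), a⟩, halive⟩
  have he : Function.Injective e := fun a b hab => by simpa [e] using hab
  have hsum := Finset.sum_preimage e ({i ∈ l.support | i.1.1 = (n', s, m)}) he.injOn
    (fun i => l i • gen hfin i.1) (by
      rintro ⟨⟨t, a⟩, h⟩ hi hne
      obtain rfl : t = (n', s, m) := (Finset.mem_filter.1 hi).2
      exact absurd ⟨a, rfl⟩ hne)
  rw [hnew] at hsum
  have := linearIndependent_iff'.1 (linearIndependent_gen hfin (n', s, m)) _
    (fun a => l (e a)) hsum a₀ (by
      rw [Finset.mem_preimage, Finset.mem_filter]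
      exact ⟨hi₀, rfl⟩)
  exact Finsupp.mem_support_iff.1 hi₀ this

/-- The class in `PH` of a generator, in a degree where it is alive. -/
noncomputable def genClass (n p : ℤ)
    (i : {i : Σ t, Fin (K.mult t) // BigradedModule.IsAlive i.1 n p}) :
    K.PH.comp n p :=
  ((K.boundaries p n).submoduleOf (K.cycles p n)).mkQ
    ⟨gen hfin i.1, genSpace_le_cycles i.2.1 i.2.le (gen_mem hfin i.1)⟩

theorem linearIndependent_genClass (n p : ℤ) : LinearIndependent F (genClass hfin n p) := by
  rw [linearIndependent_iff]
  intro l hl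
  refine eq_zero_of_linearCombination_mem_boundaries hfin n p l ?_
  have h1 : ((K.boundaries p n).submoduleOf (K.cycles p n)).mkQ (Finsupp.linearCombination F
    (fun i : {i : Σ t, Fin (K.mult t) // BigradedModule.IsAlive i.1 n p} =>
      (⟨gen hfin i.1, genSpace_le_cycles i.2.1 i.2.le (gen_mem hfin i.1)⟩ : K.cycles p n)) l)
      = 0 := by
    rw [Finsupp.apply_linearCombination]
    exact hl
  rw [Submodule.mkQ_apply, Submodule.Quotient.mk_eq_zero] at h1
  have h2 := Finsupp.apply_linearCombination F (K.cycles p n).subtype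
    (fun i : {i : Σ t, Fin (K.mult t) // BigradedModule.IsAlive i.1 n p} =>
      (⟨gen hfin i.1, genSpace_le_cycles i.2.1 i.2.le (gen_mem hfin i.1)⟩ : K.cycles p n)) l
  exact h2 ▸ h1

theorem span_genClass (hK : K.BoundedBelow) (n p : ℤ) :
    ⊤ ≤ Submodule.span F (Set.range (genClass hfin n p)) := by
  have h : K.cycles p n ≤ ((Submodule.span F (Set.range (genClass hfin n p))).comap
      ((K.boundaries p n).submoduleOf (K.cycles p n)).mkQ).map (K.cycles p n).subtype := by
    refine (cycles_le_aliveSpan_sup hfin hK n p).trans (sup_le (Submodule.span_le.2 ?_) ?_)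
    · rintro _ ⟨i, rfl⟩
      exact ⟨⟨gen hfin i.1, genSpace_le_cycles i.2.1 i.2.le (gen_mem hfin i.1)⟩,
        Submodule.subset_span ⟨i, rfl⟩, rfl⟩
    · intro b hb
      refine ⟨⟨b, K.boundaries_le_cycles p n hb⟩, Submodule.mem_comap.2 ?_, rfl⟩
      rw [Submodule.mkQ_apply, (Submodule.Quotient.mk_eq_zero
        ((K.boundaries p n).submoduleOf (K.cycles p n))).2 hb]
      exact Submodule.zero_mem _
  intro y _
  obtain ⟨⟨c, hc⟩, rfl⟩ := Submodule.mkQ_surjective _ y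
  obtain ⟨⟨c', hc'⟩, hy, rfl⟩ := h hc
  exact hy

theorem nonempty_barBasis (hfin : K.LocallyFiniteDimensional) (hK : K.BoundedBelow) :
    Nonempty (BigradedModule.BarBasis K.PH fun i : Σ t, Fin (K.mult t) => i.1) := by
  refine ⟨⟨fun n p => Module.Basis.mk (linearIndependent_genClass hfin n p)
    (span_genClass hfin hK n p), fun n p i h h' => ?_, fun n p i h h' => ?_⟩⟩
  · rw [Module.Basis.mk_apply, Module.Basis.mk_apply]
    rfl
  · rw [Module.Basis.mk_apply]
    refine (Submodule.Quotient.mk_eq_zero _).2 ?_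
    exact genSpace_le_boundaries h.1 (by have := h.le; omega) h' (gen_mem hfin i)

end FilteredChainComplex

namespace FilteredChainComplex
open BigradedModule

variable {F : Type u} [Field F] {C : Type v} [AddCommGroup C] [Module F C]
  {K : FilteredChainComplex F C}

/-! ### Ranks of the transition maps -/

/-- The map `Hₙ(𝓕ᵖ C) → Hₙ(𝓕^q C)` induced by the inclusion. -/
def transition (K : FilteredChainComplex F C) {p q : ℤ} (n : ℤ) (h : p ≤ q) :
    K.PH.comp n p →ₗ[F] K.PH.comp n q :=
  Submodule.mapQ _ _ (Submodule.inclusion (K.cycles_le_cycles n h))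
    fun _ hz => K.boundaries_le_boundaries n h hz

/-- The transition map sends a basis vector to the basis vector of the same bar if the bar is still
alive, and to zero otherwise. -/
theorem transition_basis {ι : Type w} {τ : ι → ℤ × ℤ × ℕ∞} (b : BarBasis K.PH τ) {n p q : ℤ}
    (hpq : p ≤ q) (i : {i // IsAlive (τ i) n p}) :
    (∀ h : IsAlive (τ i) n q, K.transition n hpq (b.basis n p i) = b.basis n q ⟨i, h⟩) ∧
      (¬ IsAlive (τ i) n q → K.transition n hpq (b.basis n p i) = 0) := by
  induction q, hpq using Int.leInduction with
  | base =>
    refine ⟨fun _ => ?_, fun h => absurd i.2 h⟩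
    obtain ⟨z, hz⟩ := Submodule.mkQ_surjective _ (b.basis n p i)
    rw [← hz]
    rfl
  | succ q hpq ih =>
    have hstep : K.transition n (hpq.trans (by omega : q ≤ q + 1)) (b.basis n p i) =
        K.PH.x n q (K.transition n hpq (b.basis n p i)) := by
      obtain ⟨z, hz⟩ := Submodule.mkQ_surjective _ (b.basis n p i)
      rw [← hz]
      rfl
    rw [hstep]
    constructor
    · intro h
      have h' : IsAlive (τ i) n q := h.of_le (i.2.le.trans hpq) (by omega)
      rw [ih.1 h', b.x_basis n q i h' h]
    · intro h
      by_cases h' : IsAlive (τ i) n q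
      · rw [ih.1 h', b.x_basis_eq_zero n q i h' h]
      · rw [ih.2 h', map_zero]

/-- The indices of the bars of homological degree `n` alive at both `p` and `q`. -/
def aliveSet {ι : Type w} (τ : ι → ℤ × ℤ × ℕ∞) (n p q : ℤ) : Set ι :=
  {i | IsAlive (τ i) n p ∧ IsAlive (τ i) n q}

theorem finiteDimensional_cycles (hfin : K.LocallyFiniteDimensional) (n p : ℤ) :
    FiniteDimensional F (K.cycles p n) :=
  hfin.of_le_fil inf_le_left

theorem finiteDimensional_PH (hfin : K.LocallyFiniteDimensional) (n p : ℤ) :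
    FiniteDimensional F (K.PH.comp n p) :=
  have := finiteDimensional_cycles hfin n p
  inferInstanceAs (FiniteDimensional F
    (K.cycles p n ⧸ (K.boundaries p n).submoduleOf (K.cycles p n)))

theorem finite_aliveSet (hfin : K.LocallyFiniteDimensional) {ι : Type w} {τ : ι → ℤ × ℤ × ℕ∞}
    (b : BarBasis K.PH τ) (n p q : ℤ) : (aliveSet τ n p q).Finite := by
  have := finiteDimensional_PH hfin n p
  have : Finite {i // IsAlive (τ i) n p} := Module.Finite.finite_basis (b.basis n p)
  exact (Set.finite_range fun i : {i // IsAlive (τ i) n p} => i.1).subset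
    fun i hi => ⟨⟨i, hi.1⟩, rfl⟩

theorem range_transition {ι : Type w} {τ : ι → ℤ × ℤ × ℕ∞} (b : BarBasis K.PH τ) {n p q : ℤ}
    (hpq : p ≤ q) : LinearMap.range (K.transition n hpq) =
      Submodule.span F (Set.range fun i : aliveSet τ n p q => b.basis n q ⟨i, i.2.2⟩) := by
  rw [LinearMap.range_eq_map, ← (b.basis n p).span_eq, Submodule.map_span]
  apply le_antisymm
  · refine Submodule.span_le.2 ?_
    rintro _ ⟨_, ⟨i, rfl⟩, rfl⟩
    by_cases h : IsAlive (τ i) n q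
    · rw [(transition_basis b hpq i).1 h]
      exact Submodule.subset_span ⟨⟨i, i.2, h⟩, rfl⟩
    · rw [(transition_basis b hpq i).2 h]
      exact Submodule.zero_mem _
  · refine Submodule.span_mono ?_
    rintro _ ⟨⟨i, h, h'⟩, rfl⟩
    exact ⟨_, ⟨⟨i, h⟩, rfl⟩, (transition_basis b hpq ⟨i, h⟩).1 h'⟩

theorem finrank_range_transition (hfin : K.LocallyFiniteDimensional) {ι : Type w}
    {τ : ι → ℤ × ℤ × ℕ∞} (b : BarBasis K.PH τ) {n p q : ℤ} (hpq : p ≤ q) :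
    Module.finrank F (LinearMap.range (K.transition n hpq)) = (aliveSet τ n p q).ncard := by
  have : Fintype (aliveSet τ n p q) := (finite_aliveSet hfin b n p q).fintype
  rw [range_transition b hpq, finrank_span_eq_card, Set.ncard_eq_toFinset_card', Set.toFinset_card]
  exact (b.basis n q).linearIndependent.comp
    (fun i : aliveSet τ n p q => (⟨i, i.2.2⟩ : {i // IsAlive (τ i) n q}))
    fun i j hij => Subtype.ext (congrArg (fun k => k.1) hij)

/-- The number of bars alive at both `p` and `q` is the rank of `Hₙ(𝓕ᵖ C) → Hₙ(𝓕^q C)`. -/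
theorem ncard_aliveSet_add (hfin : K.LocallyFiniteDimensional) {ι : Type w}
    {τ : ι → ℤ × ℤ × ℕ∞} (b : BarBasis K.PH τ) {n p q : ℤ} (hpq : p ≤ q) :
    (aliveSet τ n p q).ncard + Module.finrank F ↥(K.fil p n ⊓ K.boundaries q n) =
      Module.finrank F (K.cycles p n) := by
  have := finiteDimensional_cycles hfin n p
  let f : K.cycles p n →ₗ[F] K.PH.comp n q := K.transition n hpq ∘ₗ
    ((K.boundaries p n).submoduleOf (K.cycles p n)).mkQ
  have hrange : LinearMap.range f = LinearMap.range (K.transition n hpq) :=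
    LinearMap.range_comp_of_range_eq_top _ (Submodule.range_mkQ _)
  have hker : (LinearMap.ker f).map (K.cycles p n).subtype = K.fil p n ⊓ K.boundaries q n := by
    ext c
    constructor
    · rintro ⟨z, hz, rfl⟩
      exact ⟨z.2.1, (Submodule.Quotient.mk_eq_zero
        ((K.boundaries q n).submoduleOf (K.cycles q n))).1 hz⟩
    · rintro ⟨h1, h2⟩
      exact ⟨⟨c, h1, K.boundaries_le_ker q n h2⟩, (Submodule.Quotient.mk_eq_zero _).2 h2, rfl⟩
  rw [← finrank_range_transition hfin b hpq, ← hrange, ← hker,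
    LinearEquiv.finrank_eq (Submodule.equivSubtypeMap _ _).symm]
  exact f.finrank_range_add_finrank_ker

/-! ### Dimensions of the pages -/

/-- Rank–nullity for `d` on `{c ∈ 𝓕ᵗ Cₙ | d c ∈ 𝓕^q Cₙ₋₁}`. -/
theorem finrank_inf_comap (hfin : K.LocallyFiniteDimensional) (n t q : ℤ) :
    Module.finrank F ↥(K.fil t n ⊓ (K.fil q (n - 1)).comap K.d) =
      Module.finrank F (K.cycles t n) +
        Module.finrank F ↥(K.fil q (n - 1) ⊓ K.boundaries t (n - 1)) := by
  have hfd : FiniteDimensional F ↥(K.fil t n ⊓ (K.fil q (n - 1)).comap K.d) :=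
    hfin.of_le_fil inf_le_left
  have h := (K.d.domRestrict
    (K.fil t n ⊓ (K.fil q (n - 1)).comap K.d)).finrank_range_add_finrank_ker
  have hrange : LinearMap.range (K.d.domRestrict (K.fil t n ⊓ (K.fil q (n - 1)).comap K.d)) =
      K.fil q (n - 1) ⊓ K.boundaries t (n - 1) := by
    rw [boundaries, sub_add_cancel]
    ext c
    constructor
    · rintro ⟨z, rfl⟩
      exact ⟨z.2.2, z.1, z.2.1, rfl⟩
    · rintro ⟨h1, z, hz, rfl⟩
      exact ⟨⟨z, hz, h1⟩, rfl⟩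
  have hker : (LinearMap.ker (K.d.domRestrict (K.fil t n ⊓ (K.fil q (n - 1)).comap K.d))).map
      (Submodule.subtype _) = K.cycles t n := by
    ext c
    constructor
    · rintro ⟨z, hz, rfl⟩
      exact ⟨z.2.1, hz⟩
    · rintro ⟨h1, h2⟩
      refine ⟨⟨c, h1, ?_⟩, h2, rfl⟩
      change K.d c ∈ K.fil _ _
      rw [LinearMap.mem_ker.1 h2]
      exact Submodule.zero_mem _
  rw [← h, hrange, ← hker, LinearEquiv.finrank_eq (Submodule.equivSubtypeMap _ _).symm, add_comm]

theorem B_le_Z (K : FilteredChainComplex F C) (r : ℕ) (n s : ℤ) : K.B r n s ≤ K.Z r n s := by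
  refine sup_le_sup_right (le_inf inf_le_left ?_) _
  intro c hc
  have h0 : K.d c = 0 := K.boundaries_le_ker (s + r - 1) n hc.2
  change K.d c ∈ K.fil _ _
  rw [h0]
  exact Submodule.zero_mem _

theorem Z_le_fil (K : FilteredChainComplex F C) (r : ℕ) (n s : ℤ) : K.Z r n s ≤ K.fil s n :=
  sup_le inf_le_left (K.fil_mono _ _ n (by omega))

theorem finiteDimensional_page (hfin : K.LocallyFiniteDimensional) (r : ℕ) (n s : ℤ) :
    FiniteDimensional F (K.page r n s) :=
  have := hfin.of_le_fil (K.Z_le_fil r n s)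
  inferInstance

theorem finrank_page_add (hfin : K.LocallyFiniteDimensional) (r : ℕ) (n s : ℤ) :
    Module.finrank F (K.page r n s) + Module.finrank F (K.B r n s) =
      Module.finrank F (K.Z r n s) := by
  have := hfin.of_le_fil (K.Z_le_fil r n s)
  rw [← Submodule.finrank_quotient_add_finrank ((K.B r n s).submoduleOf (K.Z r n s)),
    LinearEquiv.finrank_eq (Submodule.submoduleOfEquivOfLe (K.B_le_Z r n s))]

theorem finrank_Z_add (hfin : K.LocallyFiniteDimensional) {r : ℕ} (n s : ℤ) :
    Module.finrank F (K.Z r n s) + Module.finrank F (K.cycles (s - 1) n) +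
        Module.finrank F ↥(K.fil (s - r) (n - 1) ⊓ K.boundaries (s - 1) (n - 1)) =
      Module.finrank F (K.cycles s n) +
        Module.finrank F ↥(K.fil (s - r) (n - 1) ⊓ K.boundaries s (n - 1)) +
        Module.finrank F (K.fil (s - 1) n) := by
  have h1 := hfin (s - 1) n
  have h2 : FiniteDimensional F ↥(K.fil s n ⊓ (K.fil (s - r) (n - 1)).comap K.d) :=
    hfin.of_le_fil inf_le_left
  have h := Submodule.finrank_sup_add_finrank_inf_eq
    (K.fil s n ⊓ (K.fil (s - r) (n - 1)).comap K.d) (K.fil (s - 1) n)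
  have hinf : K.fil s n ⊓ (K.fil (s - r) (n - 1)).comap K.d ⊓ K.fil (s - 1) n =
      K.fil (s - 1) n ⊓ (K.fil (s - r) (n - 1)).comap K.d := by
    rw [inf_right_comm, inf_eq_right.2 (K.fil_mono (s - 1) s n (by omega))]
  rw [hinf, finrank_inf_comap hfin, finrank_inf_comap hfin] at h
  rw [Z]
  omega

theorem finrank_B_add (hfin : K.LocallyFiniteDimensional) (r : ℕ) (n s : ℤ) :
    Module.finrank F (K.B r n s) +
        Module.finrank F ↥(K.fil (s - 1) n ⊓ K.boundaries (s + r - 1) n) =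
      Module.finrank F ↥(K.fil s n ⊓ K.boundaries (s + r - 1) n) +
        Module.finrank F (K.fil (s - 1) n) := by
  have h1 := hfin (s - 1) n
  have h2 : FiniteDimensional F ↥(K.fil s n ⊓ K.boundaries (s + r - 1) n) :=
    hfin.of_le_fil inf_le_left
  have h := Submodule.finrank_sup_add_finrank_inf_eq
    (K.fil s n ⊓ K.boundaries (s + r - 1) n) (K.fil (s - 1) n)
  rw [inf_right_comm, inf_eq_right.2 (K.fil_mono (s - 1) s n (by omega))] at h
  exact h

/-! ### Pages and endpoints of bars -/

/-- The bars of homological degree `n` born at `s`. -/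
def bornSet {ι : Type w} (τ : ι → ℤ × ℤ × ℕ∞) (n s : ℤ) : Set ι :=
  {i | (τ i).1 = n ∧ (τ i).2.1 = s}

/-- The bars of homological degree `n` which are finite and end at `s`. -/
def diedSet {ι : Type w} (τ : ι → ℤ × ℤ × ℕ∞) (n s : ℤ) : Set ι :=
  {i | (τ i).1 = n ∧ ∃ m : ℕ, (τ i).2.2 = m ∧ (τ i).2.1 + m = s}

theorem aliveSet_diff_born {ι : Type w} (τ : ι → ℤ × ℤ × ℕ∞) (n s : ℤ) {r : ℕ} (hr : 1 ≤ r) :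
    aliveSet τ n s (s + r - 1) \ aliveSet τ n (s - 1) (s + r - 1) =
      {i ∈ bornSet τ n s | (r : ℕ∞) ≤ (τ i).2.2} := by
  ext i
  generalize hi : τ i = t
  obtain ⟨n', s', m⟩ := t
  simp only [aliveSet, bornSet, Set.mem_sdiff, Set.mem_ofPred_eq, hi]
  constructor
  · rintro ⟨⟨h1, h2⟩, h3⟩
    have hs : s' = s := by
      by_contra hne
      have hle : s' ≤ s := h1.le
      exact h3 ⟨h1.of_le (by simp only; omega) (by omega), h2⟩
    subst hs
    refine ⟨⟨h1.1, rfl⟩, ?_⟩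
    obtain ⟨-, k, hk, hkm⟩ := h2
    obtain rfl : r = k + 1 := by simp only at hk; omega
    exact_mod_cast Order.add_one_le_of_lt hkm
  · rintro ⟨⟨rfl, rfl⟩, hm⟩
    have hlt : ((r - 1 : ℕ) : ℕ∞) < m :=
      lt_of_lt_of_le (by exact_mod_cast (by omega : r - 1 < r)) hm
    have h2 : IsAlive (n', s', m) n' (s' + r - 1) := ⟨rfl, r - 1, by simp only; omega, hlt⟩
    exact ⟨⟨h2.of_le le_rfl (by omega), h2⟩, fun h => by have := h.1.le; simp only at this; omega⟩

theorem aliveSet_diff_died {ι : Type w} (τ : ι → ℤ × ℤ × ℕ∞) (n s : ℤ) {r : ℕ} (hr : 1 ≤ r) :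
    aliveSet τ n (s - r) (s - 1) \ aliveSet τ n (s - r) s =
      {i ∈ diedSet τ n s | (r : ℕ∞) ≤ (τ i).2.2} := by
  ext i
  generalize hi : τ i = t
  obtain ⟨n', s', m⟩ := t
  simp only [aliveSet, diedSet, Set.mem_sdiff, Set.mem_ofPred_eq, hi]
  constructor
  · rintro ⟨⟨h1, h2⟩, h3⟩
    have h4 : ¬ IsAlive (n', s', m) n s := fun h => h3 ⟨h1, h⟩
    have hle : s' ≤ s - r := h1.le
    obtain ⟨rfl, k, hk, hkm⟩ := h2
    simp only at hk hkm
    have hm : m = (k + 1 : ℕ) := by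
      refine le_antisymm ?_ (by exact_mod_cast Order.add_one_le_of_lt hkm)
      by_contra hlt
      exact h4 ⟨rfl, k + 1, by simp only; omega, not_le.1 hlt⟩
    subst hm
    exact ⟨⟨rfl, k + 1, rfl, by omega⟩, by exact_mod_cast (by omega : r ≤ k + 1)⟩
  · rintro ⟨⟨rfl, m, rfl, rfl⟩, hm⟩
    have hm : r ≤ m := by exact_mod_cast hm
    have h2 : IsAlive (n', s', (m : ℕ∞)) n' (s' + m - 1) :=
      ⟨rfl, m - 1, by simp only; omega, Nat.cast_lt.2 (by omega)⟩
    refine ⟨⟨h2.of_le (by simp only; omega) (by omega), h2⟩, ?_⟩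
    rintro ⟨-, -, k, hk, hkm⟩
    have hkm : k < m := Nat.cast_lt.1 hkm
    simp only at hk
    omega

theorem ncard_born_add (hfin : K.LocallyFiniteDimensional) {ι : Type w}
    {τ : ι → ℤ × ℤ × ℕ∞} (b : BarBasis K.PH τ) (n s : ℤ) {r : ℕ} (hr : 1 ≤ r) :
    {i ∈ bornSet τ n s | (r : ℕ∞) ≤ (τ i).2.2}.ncard + (aliveSet τ n (s - 1) (s + r - 1)).ncard =
      (aliveSet τ n s (s + r - 1)).ncard := by
  rw [← aliveSet_diff_born τ n s hr]
  refine Set.ncard_sdiff_add_ncard_of_subset ?_ (finite_aliveSet hfin b _ _ _)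
  exact fun i hi => ⟨hi.2.of_le (by have := hi.1.le; omega) (by omega), hi.2⟩

theorem ncard_died_add (hfin : K.LocallyFiniteDimensional) {ι : Type w}
    {τ : ι → ℤ × ℤ × ℕ∞} (b : BarBasis K.PH τ) (n s : ℤ) {r : ℕ} (hr : 1 ≤ r) :
    {i ∈ diedSet τ n s | (r : ℕ∞) ≤ (τ i).2.2}.ncard + (aliveSet τ n (s - r) s).ncard =
      (aliveSet τ n (s - r) (s - 1)).ncard := by
  rw [← aliveSet_diff_died τ n s hr]
  refine Set.ncard_sdiff_add_ncard_of_subset ?_ (finite_aliveSet hfin b _ _ _)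
  exact fun i hi => ⟨hi.1, hi.2.of_le (by have := hi.1.le; omega) (by omega)⟩

/-- The dimension of a page counts the bars of length at least `r` by their endpoints. -/
theorem finrank_page (hfin : K.LocallyFiniteDimensional) {ι : Type w}
    {τ : ι → ℤ × ℤ × ℕ∞} (b : BarBasis K.PH τ) (n s : ℤ) {r : ℕ} (hr : 1 ≤ r) :
    Module.finrank F (K.page r n s) = {i ∈ bornSet τ n s | (r : ℕ∞) ≤ (τ i).2.2}.ncard +
      {i ∈ diedSet τ (n - 1) s | (r : ℕ∞) ≤ (τ i).2.2}.ncard := by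
  have h1 := finrank_page_add hfin r n s
  have h2 := finrank_Z_add hfin (r := r) n s
  have h3 := finrank_B_add hfin r n s
  have h4 := ncard_born_add hfin b n s hr
  have h5 := ncard_died_add hfin b (n - 1) s hr
  have h6 := ncard_aliveSet_add hfin b (n := n) (by omega : s - 1 ≤ s + r - 1)
  have h7 := ncard_aliveSet_add hfin b (n := n) (by omega : s ≤ s + r - 1)
  have h8 := ncard_aliveSet_add hfin b (n := n - 1) (by omega : s - r ≤ s - 1)
  have h9 := ncard_aliveSet_add hfin b (n := n - 1) (by omega : s - r ≤ s)
  omega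

end FilteredChainComplex

/-! ### Counting by length -/

theorem finsum_le_eq_add (g : ℕ → ℕ) (hg : {m | g m ≠ 0}.Finite) (r : ℕ) :
    ∑ᶠ (m : ℕ) (_ : r ≤ m), g m = g r + ∑ᶠ (m : ℕ) (_ : r + 1 ≤ m), g m := by
  have : {m | r ≤ m} = insert r {m | r + 1 ≤ m} := by
    ext m
    simp only [Set.mem_ofPred_eq, Set.mem_insert_iff]
    omega
  have h := finsum_mem_insert' (f := g) (a := r) (s := {m | r + 1 ≤ m}) (by simp)
    (hg.subset fun m hm => hm.2)
  rw [← this] at h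
  exact h

theorem exists_finsum_le_eq_zero (g : ℕ → ℕ) (hg : {m | g m ≠ 0}.Finite) :
    ∃ R, ∀ r ≥ R, ∑ᶠ (m : ℕ) (_ : r ≤ m), g m = 0 := by
  obtain ⟨R, hR⟩ := hg.bddAbove
  refine ⟨R + 1, fun r hr => finsum_mem_eq_zero_of_forall_eq_zero (s := {m | r ≤ m})
    fun m (hm : r ≤ m) => ?_⟩
  by_contra hne
  have : m ≤ R := hR hne
  omega

theorem finite_setOf_ncard_ne_zero {ι : Type*} {T : Set ι} (hT : T.Finite) (f : ι → ℕ∞) :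
    {m : ℕ | {i ∈ T | f i = m}.ncard ≠ 0}.Finite := by
  refine ((hT.image f).preimage Nat.cast_injective.injOn).subset fun m hm => ?_
  obtain ⟨i, hi, hm⟩ := Set.nonempty_of_ncard_ne_zero hm
  exact ⟨i, hi, hm⟩

/-- Counting the elements of a finite set by the values of a function to `ℕ∞`. -/
theorem ncard_sep_le_eq_add_finsum {ι : Type*} {T : Set ι} (hT : T.Finite) (f : ι → ℕ∞) (r : ℕ) :
    {i ∈ T | (r : ℕ∞) ≤ f i}.ncard =
      {i ∈ T | f i = ⊤}.ncard + ∑ᶠ (m : ℕ) (_ : r ≤ m), {i ∈ T | f i = m}.ncard := by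
  have hS := finite_setOf_ncard_ne_zero hT f
  obtain ⟨R, hR⟩ := hS.bddAbove
  obtain ⟨R', hR'⟩ := exists_finsum_le_eq_zero _ hS
  -- descending induction on `r`, written as an induction on `k ≥ R + R' + 1 - r`
  have key : ∀ k r : ℕ, R + R' + 1 ≤ r + k → {i ∈ T | (r : ℕ∞) ≤ f i}.ncard =
      {i ∈ T | f i = ⊤}.ncard + ∑ᶠ (m : ℕ) (_ : r ≤ m), {i ∈ T | f i = m}.ncard := by
    intro k
    induction k with
    | zero =>
      intro r hr
      rw [hR' r (by omega), add_zero]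
      congr 1
      ext i
      refine and_congr_right fun hi => ⟨fun h => ?_, fun h => h ▸ le_top⟩
      by_contra hne
      obtain ⟨m, hm⟩ := ENat.ne_top_iff_exists.1 hne
      have hmR : m ≤ R := hR (Set.ncard_ne_zero_of_mem (a := i) ⟨hi, hm.symm⟩
        (hT.subset fun j hj => hj.1))
      rw [← hm] at h
      have := Nat.cast_le.1 h
      omega
    | succ k ih =>
      intro r hr
      rw [finsum_le_eq_add _ hS, add_left_comm, ← ih (r + 1) (by omega),
        ← Set.ncard_union_eq _ (hT.subset fun j hj => hj.1) (hT.subset fun j hj => hj.1)]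
      · congr 1
        ext i
        simp only [Set.mem_ofPred_eq, Set.mem_union, ← and_or_left]
        refine and_congr_right fun _ => ?_
        rw [le_iff_eq_or_lt, eq_comm, Nat.cast_add, Nat.cast_one,
          ENat.add_one_le_iff (ENat.natCast_ne_top r)]
      · refine Set.disjoint_left.2 fun i h1 h2 => ?_
        have h3 := h2.2
        rw [h1.2] at h3
        have := Nat.cast_le.1 h3
        omega
  exact key (R + R' + 1) r (by omega)

namespace FilteredChainComplex
open BigradedModule

variable {F : Type u} [Field F] {C : Type v} [AddCommGroup C] [Module F C]
  {K : FilteredChainComplex F C}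

/-! ### Multiplicities -/

theorem isPHDecomposition_iff {ι : Type w} (τ : ι → ℤ × ℤ × ℕ∞) :
    K.IsPHDecomposition τ ↔ (∀ i, (τ i).2.2 ≠ 0) ∧ Nonempty (BarBasis K.PH τ) :=
  and_congr_right fun _ => iso_directSum_cyclic_iff K.PH τ

/-- The decomposition of `PH` given by the generators. -/
theorem isPHDecomposition_mult (hK : K.BoundedBelow) (hfin : K.LocallyFiniteDimensional) :
    K.IsPHDecomposition fun i : Σ t, Fin (K.mult t) => i.1 := by
  refine (isPHDecomposition_iff _).2 ⟨?_, nonempty_barBasis hfin hK⟩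
  rintro ⟨⟨n, s, m⟩, a⟩ (rfl : m = 0)
  rw [K.mult_zero] at a
  exact a.elim0

variable {ι : Type w} {τ : ι → ℤ × ℤ × ℕ∞}

theorem finite_bornSet (hfin : K.LocallyFiniteDimensional) (h : K.IsPHDecomposition τ) (n s : ℤ) :
    (bornSet τ n s).Finite := by
  obtain ⟨h0, ⟨b⟩⟩ := (isPHDecomposition_iff τ).1 h
  refine (finite_aliveSet hfin b n s s).subset ?_
  rintro i ⟨h1, h2⟩
  have : IsAlive (τ i) n s := ⟨h1, 0, by simp [h2], by
    simpa using pos_iff_ne_zero.2 (h0 i)⟩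
  exact ⟨this, this⟩

theorem finite_diedSet (hfin : K.LocallyFiniteDimensional) (h : K.IsPHDecomposition τ) (n s : ℤ) :
    (diedSet τ n s).Finite := by
  obtain ⟨h0, ⟨b⟩⟩ := (isPHDecomposition_iff τ).1 h
  refine (finite_aliveSet hfin b n (s - 1) (s - 1)).subset ?_
  rintro i ⟨h1, m, hm, h2⟩
  have hm0 : m ≠ 0 := by
    rintro rfl
    exact h0 i hm
  have : IsAlive (τ i) n (s - 1) := ⟨h1, m - 1, by omega, by
    rw [hm]
    exact Nat.cast_lt.2 (by omega)⟩
  exact ⟨this, this⟩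

theorem bornSet_sep (τ : ι → ℤ × ℤ × ℕ∞) (n s : ℤ) (m : ℕ∞) :
    {i ∈ bornSet τ n s | (τ i).2.2 = m} = {i | τ i = (n, s, m)} := by
  ext i
  simp [bornSet, Prod.ext_iff, and_assoc]

theorem diedSet_sep (τ : ι → ℤ × ℤ × ℕ∞) (n s : ℤ) (m : ℕ) :
    {i ∈ diedSet τ n s | (τ i).2.2 = m} = {i | τ i = (n, s - m, (m : ℕ∞))} := by
  ext i
  generalize hi : τ i = t
  obtain ⟨n', s', m'⟩ := t
  simp only [diedSet, Set.mem_ofPred_eq, hi, Prod.mk.injEq]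
  constructor
  · rintro ⟨⟨h1, k, rfl, h2⟩, h3⟩
    obtain rfl : k = m := Nat.cast_injective h3
    exact ⟨h1, by omega, rfl⟩
  · rintro ⟨rfl, rfl, rfl⟩
    exact ⟨⟨rfl, m, rfl, by omega⟩, rfl⟩

theorem diedSet_sep_top (τ : ι → ℤ × ℤ × ℕ∞) (n s : ℤ) :
    {i ∈ diedSet τ n s | (τ i).2.2 = ⊤} = ∅ := by
  ext i
  simp only [diedSet, Set.mem_ofPred_eq, Set.mem_empty_iff_false, iff_false]
  rintro ⟨⟨-, m, hm, -⟩, h⟩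
  exact ENat.natCast_ne_top m (hm.symm.trans h)

/-- The family `τ` lists the types of the summands of a decomposition of `PH`, exactly `ν n s m` of
which have type `(n, s, m)`. -/
def IsMultiplicityOf (K : FilteredChainComplex F C) (τ : ι → ℤ × ℤ × ℕ∞)
    (ν : ℤ → ℤ → ℕ∞ → ℕ) : Prop :=
  K.IsPHDecomposition τ ∧ ∀ n s m, {i | τ i = (n, s, m)}.ncard = ν n s m

variable {ν : ℤ → ℤ → ℕ∞ → ℕ}

theorem IsMultiplicityOf.finite_born (h : K.IsMultiplicityOf τ ν)
    (hfin : K.LocallyFiniteDimensional) (n s : ℤ) : {m : ℕ | ν n s m ≠ 0}.Finite := by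
  simpa only [bornSet_sep, h.2] using
    finite_setOf_ncard_ne_zero (finite_bornSet hfin h.1 n s) fun i => (τ i).2.2

theorem IsMultiplicityOf.finite_died (h : K.IsMultiplicityOf τ ν)
    (hfin : K.LocallyFiniteDimensional) (n s : ℤ) : {m : ℕ | ν n (s - m) m ≠ 0}.Finite := by
  simpa only [diedSet_sep, h.2] using
    finite_setOf_ncard_ne_zero (finite_diedSet hfin h.1 n s) fun i => (τ i).2.2

theorem IsMultiplicityOf.finite (h : K.IsMultiplicityOf τ ν)
    (hfin : K.LocallyFiniteDimensional) (n s : ℤ) :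
    {m : ℕ | ν n s m + ν (n - 1) (s - m) m ≠ 0}.Finite := by
  refine ((h.finite_born hfin n s).union (h.finite_died hfin (n - 1) s)).subset fun m hm => ?_
  simp only [Set.mem_ofPred_eq, Set.mem_union] at hm ⊢
  omega

theorem IsMultiplicityOf.ncard_born (h : K.IsMultiplicityOf τ ν)
    (hfin : K.LocallyFiniteDimensional) (n s : ℤ) (r : ℕ) :
    {i ∈ bornSet τ n s | (r : ℕ∞) ≤ (τ i).2.2}.ncard =
      ν n s ⊤ + ∑ᶠ (m : ℕ) (_ : r ≤ m), ν n s m := by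
  rw [ncard_sep_le_eq_add_finsum (finite_bornSet hfin h.1 n s)]
  simp only [bornSet_sep, h.2]

theorem IsMultiplicityOf.ncard_died (h : K.IsMultiplicityOf τ ν)
    (hfin : K.LocallyFiniteDimensional) (n s : ℤ) (r : ℕ) :
    {i ∈ diedSet τ n s | (r : ℕ∞) ≤ (τ i).2.2}.ncard =
      ∑ᶠ (m : ℕ) (_ : r ≤ m), ν n (s - m) m := by
  rw [ncard_sep_le_eq_add_finsum (finite_diedSet hfin h.1 n s), diedSet_sep_top]
  simp only [diedSet_sep, h.2, Set.ncard_empty, zero_add]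

theorem IsMultiplicityOf.finrank_page (h : K.IsMultiplicityOf τ ν)
    (hfin : K.LocallyFiniteDimensional) {r : ℕ} (hr : 1 ≤ r) (n s : ℤ) :
    Module.finrank F (K.page r n s) =
      ν n s ⊤ + ∑ᶠ (m : ℕ) (_ : r ≤ m), (ν n s m + ν (n - 1) (s - m) m) := by
  obtain ⟨-, ⟨b⟩⟩ := (isPHDecomposition_iff τ).1 h.1
  rw [FilteredChainComplex.finrank_page hfin b n s hr, h.ncard_born hfin, h.ncard_died hfin,
    add_assoc]
  congr 1
  exact (finsum_mem_add_distrib' (s := {m | r ≤ m})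
    ((h.finite_born hfin n s).subset fun m hm => hm.2)
    ((h.finite_died hfin (n - 1) s).subset fun m hm => hm.2)).symm

theorem IsMultiplicityOf.eq_page_sub (h : K.IsMultiplicityOf τ ν)
    (hfin : K.LocallyFiniteDimensional) (n s : ℤ) {m : ℕ} (hm : 1 ≤ m) :
    (ν n s m : ℤ) = (Module.finrank F (K.page m n s) : ℤ)
      - (Module.finrank F (K.page (m + 1) n s) : ℤ) - (ν (n - 1) (s - m) m : ℤ) := by
  have h1 := h.finrank_page hfin hm n s
  have h2 := h.finrank_page hfin (by omega : 1 ≤ m + 1) n s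
  rw [finsum_le_eq_add _ (h.finite hfin n s)] at h1
  omega

theorem IsMultiplicityOf.exists_finrank_page_eq (h : K.IsMultiplicityOf τ ν)
    (hfin : K.LocallyFiniteDimensional) (n s : ℤ) :
    ∃ R, ∀ r ≥ R, Module.finrank F (K.page r n s) = ν n s ⊤ := by
  obtain ⟨R, hR⟩ := exists_finsum_le_eq_zero _ (h.finite hfin n s)
  refine ⟨R + 1, fun r hr => ?_⟩
  rw [h.finrank_page hfin (by omega), hR r (by omega), add_zero]

/-- The numbers of bars born at `s` of length at least `r` are differences of ranks, so they do not
depend on the decomposition; they determine the multiplicities. -/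
theorem IsMultiplicityOf.unique (hfin : K.LocallyFiniteDimensional) (h : K.IsMultiplicityOf τ ν)
    {ι' : Type*} {τ' : ι' → ℤ × ℤ × ℕ∞} {ν' : ℤ → ℤ → ℕ∞ → ℕ} (h' : K.IsMultiplicityOf τ' ν') :
    ν = ν' := by
  obtain ⟨h0, ⟨b⟩⟩ := (isPHDecomposition_iff τ).1 h.1
  obtain ⟨h0', ⟨b'⟩⟩ := (isPHDecomposition_iff τ').1 h'.1
  have hborn : ∀ n s : ℤ, ∀ r : ℕ, 1 ≤ r → ν n s ⊤ + ∑ᶠ (m : ℕ) (_ : r ≤ m), ν n s m =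
      ν' n s ⊤ + ∑ᶠ (m : ℕ) (_ : r ≤ m), ν' n s m := by
    intro n s r hr
    rw [← h.ncard_born hfin, ← h'.ncard_born hfin]
    have h1 := ncard_born_add hfin b n s hr
    have h2 := ncard_born_add hfin b' n s hr
    have h3 := ncard_aliveSet_add hfin b (n := n) (by omega : s - 1 ≤ s + r - 1)
    have h4 := ncard_aliveSet_add hfin b (n := n) (by omega : s ≤ s + r - 1)
    have h5 := ncard_aliveSet_add hfin b' (n := n) (by omega : s - 1 ≤ s + r - 1)
    have h6 := ncard_aliveSet_add hfin b' (n := n) (by omega : s ≤ s + r - 1)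
    omega
  funext n s m
  induction m using ENat.recTopCoe with
  | top =>
    obtain ⟨R, hR⟩ := exists_finsum_le_eq_zero _ (h.finite_born hfin n s)
    obtain ⟨R', hR'⟩ := exists_finsum_le_eq_zero _ (h'.finite_born hfin n s)
    have := hborn n s (R + R' + 1) (by omega)
    rwa [hR _ (by omega), hR' _ (by omega)] at this
  | coe m =>
    rcases Nat.eq_zero_or_pos m with rfl | hm
    · rw [← h.2, ← h'.2]
      have e1 : {i | τ i = (n, s, ((0 : ℕ) : ℕ∞))} = ∅ :=
        Set.eq_empty_of_forall_notMem fun i (hi : τ i = _) => h0 i (by rw [hi]; rfl)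
      have e2 : {i | τ' i = (n, s, ((0 : ℕ) : ℕ∞))} = ∅ :=
        Set.eq_empty_of_forall_notMem fun i (hi : τ' i = _) => h0' i (by rw [hi]; rfl)
      rw [e1, e2, Set.ncard_empty, Set.ncard_empty]
    · have h1 := hborn n s m hm
      have h2 := hborn n s (m + 1) (by omega)
      rw [finsum_le_eq_add _ (h.finite_born hfin n s),
        finsum_le_eq_add _ (h'.finite_born hfin n s)] at h1
      omega

theorem isMultiplicityOf_mult (hK : K.BoundedBelow) (hfin : K.LocallyFiniteDimensional) :
    K.IsMultiplicityOf (fun i : Σ t, Fin (K.mult t) => i.1) fun n s m => K.mult (n, s, m) := by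
  refine ⟨isPHDecomposition_mult hK hfin, fun n s m => ?_⟩
  have : {i : Σ t, Fin (K.mult t) | i.1 = (n, s, m)} =
      Set.range fun a : Fin (K.mult (n, s, m)) => (⟨(n, s, m), a⟩ : Σ t, Fin (K.mult t)) := by
    ext ⟨t, a⟩
    constructor
    · rintro (rfl : t = _)
      exact ⟨a, rfl⟩
    · rintro ⟨a', ha'⟩
      exact (congrArg Sigma.fst ha').symm
  rw [this]
  exact (Set.ncard_range_of_injective sigma_mk_injective).trans (Nat.card_fin _)

theorem isMultiplicity_mult (hK : K.BoundedBelow) (hfin : K.LocallyFiniteDimensional) :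
    K.IsMultiplicity fun n s m => K.mult (n, s, m) := by
  refine ⟨⟨_, _, isPHDecomposition_mult hK hfin⟩, fun ι τ h => ⟨finite_bornSet hfin h, ?_⟩⟩
  have h' : K.IsMultiplicityOf τ fun n s m => {i | τ i = (n, s, m)}.ncard := ⟨h, fun _ _ _ => rfl⟩
  have := h'.unique hfin (isMultiplicityOf_mult hK hfin)
  exact fun n s m => congrFun (congrFun (congrFun this n) s) m

/-! ### The infinite page -/

theorem Z_antitone (K : FilteredChainComplex F C) (n s : ℤ) : Antitone fun r => K.Z r n s :=
  fun r r' h => sup_le_sup_right (inf_le_inf_left _ (Submodule.comap_mono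
    (K.fil_mono _ _ _ (by omega)))) _

theorem B_monotone (K : FilteredChainComplex F C) (n s : ℤ) : Monotone fun r => K.B r n s :=
  fun r r' h => sup_le_sup_right (inf_le_inf_left _ (Submodule.map_mono
    (K.fil_mono _ _ _ (by omega)))) _

/-- `Zʳ` is stationary since `𝓕ˢ⁻ʳ Cₙ₋₁ = 0` for large `r`. -/
theorem exists_Z_eq_iInf (hK : K.BoundedBelow) (n s : ℤ) :
    ∃ R, ∀ r ≥ R, K.Z r n s = ⨅ r, K.Z r n s := by
  obtain ⟨p, hp⟩ := hK (n - 1)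
  have hbot : ∀ q ≤ p, K.fil q (n - 1) = ⊥ := fun q hq =>
    eq_bot_iff.2 ((K.fil_mono q p _ hq).trans hp.le)
  have heq : ∀ r ≥ (s - p).toNat, K.Z r n s = K.Z (s - p).toNat n s := fun r hr => by
    rw [Z, Z, hbot _ (by omega), hbot _ (by omega)]
  refine ⟨(s - p).toNat, fun r hr => le_antisymm (le_iInf fun r' => ?_) (iInf_le _ r)⟩
  rw [heq r hr, ← heq (max r' (s - p).toNat) (le_max_right _ _)]
  exact K.Z_antitone n s (le_max_left _ _)

/-- `Bʳ` is stationary since it increases inside the finite-dimensional space `𝓕ˢ Cₙ`. -/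
theorem exists_B_eq_iSup (hfin : K.LocallyFiniteDimensional) (n s : ℤ) :
    ∃ R, ∀ r ≥ R, K.B r n s = ⨆ r, K.B r n s := by
  have := hfin s n
  have hle : ∀ r, K.B r n s ≤ K.fil s n := fun r => (K.B_le_Z r n s).trans (K.Z_le_fil r n s)
  have hB : Monotone fun r => (K.B r n s).submoduleOf (K.fil s n) := fun r r' h =>
    Submodule.comap_mono (K.B_monotone n s h)
  obtain ⟨R, hR⟩ := monotone_stabilizes_iff_noetherian.2
    (inferInstance : IsNoetherian F (K.fil s n)) ⟨_, hB⟩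
  have heq : ∀ r ≥ R, K.B r n s = K.B R n s := fun r hr => by
    have h := congrArg (Submodule.map (K.fil s n).subtype) (hR r hr)
    simp only [OrderHom.coe_mk, Submodule.submoduleOf, Submodule.map_comap_subtype] at h
    rw [inf_eq_right.2 (hle r), inf_eq_right.2 (hle R)] at h
    exact h.symm
  refine ⟨R, fun r hr => le_antisymm (le_iSup (fun r => K.B r n s) r) (iSup_le fun r' => ?_)⟩
  rw [heq r hr, ← heq (max r' R) (le_max_right _ _)]
  exact K.B_monotone n s (le_max_left _ _)

theorem collapsesLocally (hK : K.BoundedBelow) (hfin : K.LocallyFiniteDimensional) :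
    K.CollapsesLocally := by
  intro n s
  obtain ⟨R, hR⟩ := exists_Z_eq_iInf hK n s
  obtain ⟨R', hR'⟩ := exists_B_eq_iSup hfin n s
  refine ⟨R + R', fun r hr => ?_⟩
  unfold page pageInfty
  rw [← hR r (by omega), ← hR' r (by omega)]
  exact ⟨LinearEquiv.refl F _⟩

theorem finiteDimensional_pageInfty (hK : K.BoundedBelow) (hfin : K.LocallyFiniteDimensional)
    (n s : ℤ) : FiniteDimensional F (K.pageInfty n s) := by
  obtain ⟨R, hR⟩ := collapsesLocally hK hfin n s
  obtain ⟨e⟩ := hR (R + 1) (by omega)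
  have := finiteDimensional_page hfin (R + 1) n s
  exact e.finiteDimensional

theorem IsMultiplicityOf.finrank_pageInfty (h : K.IsMultiplicityOf τ ν) (hK : K.BoundedBelow)
    (hfin : K.LocallyFiniteDimensional) (n s : ℤ) :
    ν n s ⊤ = Module.finrank F (K.pageInfty n s) := by
  obtain ⟨R, hR⟩ := collapsesLocally hK hfin n s
  obtain ⟨R', hR'⟩ := h.exists_finrank_page_eq hfin n s
  obtain ⟨e⟩ := hR (R + R' + 1) (by omega)
  rw [← hR' (R + R' + 1) (by omega), e.finrank_eq]

theorem mult_eq_zero_of_fil_eq_bot {p n s : ℤ} (hp : K.fil p n = ⊥) (hs : s ≤ p) (m : ℕ∞) :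
    K.mult (n, s, m) = 0 := by
  have h : K.genSpace (n, s, m) = ⊥ := eq_bot_iff.2 (((K.genSpace_le _).trans
    (inf_le_left.trans inf_le_left)).trans ((K.fil_mono s p n hs).trans hp.le))
  rw [mult, h, finrank_bot]

theorem finrank_page_eq_zero {p n s : ℤ} (hp : K.fil p n = ⊥) (hs : s ≤ p) (r : ℕ) :
    Module.finrank F (K.page r n s) = 0 := by
  have h : K.Z r n s = ⊥ :=
    eq_bot_iff.2 ((K.Z_le_fil r n s).trans ((K.fil_mono s p n hs).trans hp.le))
  have : Subsingleton (K.Z r n s) := by rw [h]; infer_instance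
  have : Subsingleton (K.page r n s) := (Submodule.mkQ_surjective _).subsingleton
  exact Module.finrank_zero_of_subsingleton

/-! ### Comparison of two complexes -/

section TwoComplexes

variable {C' : Type w} [AddCommGroup C'] [Module F C'] {K' : FilteredChainComplex F C'}

theorem isMultiplicityOf_mult_of_iso (hK : K.BoundedBelow) (hfin : K.LocallyFiniteDimensional)
    (h : K.PH.Iso K'.PH) : K'.IsMultiplicityOf (fun i : Σ t, Fin (K.mult t) => i.1)
      fun n s m => K.mult (n, s, m) := by
  obtain ⟨h1, h2⟩ := isMultiplicityOf_mult hK hfin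
  obtain ⟨h0, ⟨b⟩⟩ := (isPHDecomposition_iff _).1 h1
  obtain ⟨e, he⟩ := h
  exact ⟨(isPHDecomposition_iff _).2 ⟨h0, ⟨b.ofIso e he⟩⟩, h2⟩

theorem iso_of_mult_eq (hK : K.BoundedBelow) (hfin : K.LocallyFiniteDimensional)
    (hK' : K'.BoundedBelow) (hfin' : K'.LocallyFiniteDimensional) (h : K.mult = K'.mult) :
    K.PH.Iso K'.PH := by
  obtain ⟨b⟩ := nonempty_barBasis hfin hK
  obtain ⟨b'⟩ := nonempty_barBasis hfin' hK'
  rw [← h] at b'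
  exact b.iso b'

/-- Below the uniform lower bound all multiplicities vanish, so the formula for the multiplicities
in terms of the pages determines them by induction on the birth `s`. -/
theorem mult_eq_of_finrank_page_eq (hK : K.BoundedBelow) (hfin : K.LocallyFiniteDimensional)
    (hK' : K'.BoundedBelow) (hfin' : K'.LocallyFiniteDimensional) {p : ℤ}
    (hp : ∀ n, K.fil p n = ⊥)
    (h : ∀ r : ℕ, 1 ≤ r → ∀ n s : ℤ,
      Module.finrank F (K.page r n s) = Module.finrank F (K'.page r n s)) :
    K.mult = K'.mult := by
  have hν := isMultiplicityOf_mult hK hfin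
  have hν' := isMultiplicityOf_mult hK' hfin'
  have htop : ∀ n s, K.mult (n, s, ⊤) = K'.mult (n, s, ⊤) := fun n s => by
    obtain ⟨R, hR⟩ := hν.exists_finrank_page_eq hfin n s
    obtain ⟨R', hR'⟩ := hν'.exists_finrank_page_eq hfin' n s
    rw [← hR (R + R' + 1) (by omega), ← hR' (R + R' + 1) (by omega), h _ (by omega)]
  have hlow : ∀ s ≤ p, ∀ n, ∀ m : ℕ, 1 ≤ m → K.mult (n, s, m) = K'.mult (n, s, m) := by
    intro s hs n m hm
    have h1 := hν'.eq_page_sub hfin' n s hm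
    have h2 := finrank_page_eq_zero (hp n) hs m
    rw [← h m hm, h2] at h1
    rw [mult_eq_zero_of_fil_eq_bot (hp n) hs]
    omega
  have hall : ∀ k : ℕ, ∀ s ≤ p + k, ∀ n, ∀ m : ℕ, 1 ≤ m →
      K.mult (n, s, m) = K'.mult (n, s, m) := by
    intro k
    induction k with
    | zero => exact fun s hs => hlow s (by simpa using hs)
    | succ k ih =>
      intro s hs n m hm
      have h1 := hν.eq_page_sub hfin n s hm
      have h2 := hν'.eq_page_sub hfin' n s hm
      rw [← h m hm, ← h (m + 1) (by omega), ← ih (s - m) (by omega) (n - 1) m hm] at h2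
      omega
  funext ⟨n, s, m⟩
  induction m using ENat.recTopCoe with
  | top => exact htop n s
  | coe m =>
    rcases Nat.eq_zero_or_pos m with rfl | hm
    · exact (K.mult_zero n s).trans (K'.mult_zero n s).symm
    · exact hall (s - p).toNat s (by omega) n m hm

end TwoComplexes

end FilteredChainComplex

/-! ### Persistent homology and the spectral sequence determine each other -/

open FilteredChainComplex in
theorem theorem1p8 {F : Type u} [Field F] {C : Type v} [AddCommGroup C] [Module F C]
    (K : FilteredChainComplex F C) (hK : K.BoundedBelow) (hfin : K.LocallyFiniteDimensional) :
    ∃ ν : ℤ → ℤ → ℕ∞ → ℕ, K.IsMultiplicity ν ∧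
      -- (1) the pages in terms of the multiplicities
      (∀ r : ℕ, 1 ≤ r → ∀ n s : ℤ,
        FiniteDimensional F (K.page r n s) ∧
        {m : ℕ | ν n s m + ν (n - 1) (s - m) m ≠ 0}.Finite ∧
        Module.finrank F (K.page r n s) =
          ν n s ⊤ + ∑ᶠ (m : ℕ) (_ : r ≤ m), (ν n s m + ν (n - 1) (s - m) m)) ∧
      -- persistent homology determines the spectral sequence
      (∀ (C' : Type w) [AddCommGroup C'] [Module F C'] (K' : FilteredChainComplex F C'),
        K'.BoundedBelow → K'.LocallyFiniteDimensional → K.PH.Iso K'.PH →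
          (∀ r : ℕ, 1 ≤ r → ∀ n s : ℤ, Nonempty (K.page r n s ≃ₗ[F] K'.page r n s)) ∧
          ∀ n s : ℤ, Nonempty (K.pageInfty n s ≃ₗ[F] K'.pageInfty n s)) ∧
      -- (2) local collapse, and the multiplicities in terms of the pages
      K.CollapsesLocally ∧
      (∀ n s : ℤ, FiniteDimensional F (K.pageInfty n s) ∧
        ν n s ⊤ = Module.finrank F (K.pageInfty n s)) ∧
      (∀ (n s : ℤ) (m : ℕ), 1 ≤ m →
        (ν n s m : ℤ) = (Module.finrank F (K.page m n s) : ℤ)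
          - (Module.finrank F (K.page (m + 1) n s) : ℤ) - (ν (n - 1) (s - m) m : ℤ)) ∧
      -- if the filtration is uniformly bounded below, the spectral sequence determines
      -- the persistent homology
      (K.UniformlyBoundedBelow →
        (∃ S : ℤ, ∀ (n s : ℤ) (m : ℕ∞), s < S → ν n s m = 0) ∧
        ∀ (C' : Type w) [AddCommGroup C'] [Module F C'] (K' : FilteredChainComplex F C'),
          K'.BoundedBelow → K'.LocallyFiniteDimensional →
          (∀ r : ℕ, 1 ≤ r → ∀ n s : ℤ, Nonempty (K.page r n s ≃ₗ[F] K'.page r n s)) →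
            K.PH.Iso K'.PH) := by
  have hν := isMultiplicityOf_mult hK hfin
  refine ⟨_, isMultiplicity_mult hK hfin, fun r hr n s => ⟨finiteDimensional_page hfin r n s,
    hν.finite hfin n s, hν.finrank_page hfin hr n s⟩, ?_, collapsesLocally hK hfin,
    fun n s => ⟨finiteDimensional_pageInfty hK hfin n s, hν.finrank_pageInfty hK hfin n s⟩,
    fun n s m hm => hν.eq_page_sub hfin n s hm, ?_⟩
  · intro C' _ _ K' hK' hfin' hiso
    have hν' := isMultiplicityOf_mult_of_iso hK hfin hiso
    refine ⟨fun r hr n s => ?_, fun n s => ?_⟩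
    · have := finiteDimensional_page hfin r n s
      have := finiteDimensional_page hfin' r n s
      exact FiniteDimensional.nonempty_linearEquiv_of_finrank_eq
        ((hν.finrank_page hfin hr n s).trans (hν'.finrank_page hfin' hr n s).symm)
    · have := finiteDimensional_pageInfty hK hfin n s
      have := finiteDimensional_pageInfty hK' hfin' n s
      exact FiniteDimensional.nonempty_linearEquiv_of_finrank_eq
        ((hν.finrank_pageInfty hK hfin n s).symm.trans (hν'.finrank_pageInfty hK' hfin' n s))
  · rintro ⟨p, hp⟩
    refine ⟨⟨p + 1, fun n s m hs => mult_eq_zero_of_fil_eq_bot (hp n) (by omega) m⟩, ?_⟩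
    intro C' _ _ K' hK' hfin' hpage
    refine iso_of_mult_eq hK hfin hK' hfin'
      (mult_eq_of_finrank_page_eq hK hfin hK' hfin' hp fun r hr n s => ?_)
    obtain ⟨e⟩ := hpage r hr n s
    exact e.finrank_eq
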